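/- A graph is a split graph if its vertex set can be partitioned into a clique $C$ and an independent set $I$ (either may be empty); it is a complete split graph if there is such a partition in which moreover every vertex of $C$ is adjacent to every vertex of $I$. A graph is a cluster graph if each of its connected components is a clique. For graph classes $\mathcal C_1,\mathcal C_2$, the vertex deletion problem $\mathcal C_1\to\mathcal C_2$ is: given a finite simple graph $G\in\mathcal C_1$, find a set $V_-\subseteq V(G)$ of minimum cardinality such that $G-V_-\in\mathcal C_2$. Its decision version consists of the pairs $(G,k)$ of a finite simple graph $G$ and $k\in\mathbb N$ such that $G\in\mathcal C_1$ and some $V_-\subseteq V(G)$ with $|V_-|\le k$ satisfies $G-V_-\in\mathcal C_2$. Graphs are encoded by their adjacency matrices, and $k$ in binary. **Corollary.** The problems $\text{split}\to\text{cluster}$ and $\text{split}\to\text{complete split}$ are in P. That is, for each of the two problems there is a deterministic Turing machine that, given any split graph $G$, outputs in time polynomial in the input length a minimum solution $V_-$; and there is a deterministic Turing machine that decides in polynomial time, given any finite simple graph $G$ and any $k\in\mathbb N$, whether $(G,k)$ belongs to the decision version. -/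

import Mathlib

open Computability Turing

namespace VertexDeletion

/-! ### Graph classes -/

/-- A class of (simple, undirected) graphs. -/
abbrev GraphClass : Type 1 := ∀ ⦃V : Type⦄, SimpleGraph V → Prop

/-- Split graphs: the vertices can be partitioned into a clique `C` and an independent set `Cᶜ`
(either of which may be empty). -/
def IsSplit : GraphClass := fun V G =>
  ∃ C : Set V, G.IsClique C ∧ G.IsIndepSet Cᶜ

/-- Complete split graphs: there is a split partition in which every vertex of the clique is
adjacent to every vertex of the independent set. -/
def IsCompleteSplit : GraphClass := fun V G =>
  ∃ C : Set V, G.IsClique C ∧ G.IsIndepSet Cᶜ ∧ ∀ u ∈ C, ∀ v ∈ Cᶜ, G.Adj u v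

/-- Cluster graphs: every connected component is a clique. -/
def IsCluster : GraphClass := fun _ G =>
  ∀ K : G.ConnectedComponent, G.IsClique K.supp

/-! ### Vertex deletion -/

/-- Deleting the vertices of `S` from `G` leaves a graph in the class `C`. -/
def IsDeletionSet (C : GraphClass) {V : Type} (G : SimpleGraph V) (S : Finset V) : Prop :=
  C (G.induce ((S : Set V)ᶜ))

/-- `S` is a solution of minimum cardinality. -/
def IsMinDeletionSet (C : GraphClass) {V : Type} (G : SimpleGraph V) (S : Finset V) : Prop :=
  IsDeletionSet C G S ∧ ∀ T : Finset V, IsDeletionSet C G T → S.card ≤ T.card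

/-! ### Instances and their encodings -/

/-- Finite graphs, given on the vertex set `{0, …, n - 1}`. -/
abbrev FinGraph : Type := Σ n : ℕ, SimpleGraph (Fin n)

open Classical in
/-- A graph is written as its adjacency matrix, row by row, a comma ending each row. -/
noncomputable def encodeGraph (G : FinGraph) : List Γ' :=
  (List.finRange G.1).flatMap fun i =>
    (List.finRange G.1).map (fun j => Γ'.bit (decide (G.2.Adj i j))) ++ [Γ'.comma]

/-- A graph together with a number `k`: the graph, followed by `k` in binary. -/
noncomputable def encodeGraphNat (x : FinGraph × ℕ) : List Γ' :=
  encodeGraph x.1 ++ (encodeNat x.2).map Γ'.bit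

/-- A set of vertices is written as its characteristic vector. -/
def encodeVertexSet {n : ℕ} (S : Finset (Fin n)) : List Bool :=
  (List.finRange n).map fun i => decide (i ∈ S)

/-! ### Polynomial time -/

open Classical in
/-- Membership in `L` is decided by a multi-stack Turing machine in time polynomial in the length
of the encoded instance. -/
def DecidableInPolyTime {α Γ : Type} (encode : α → List Γ) (L : Set α) : Prop :=
  Nonempty (TM2ComputableInPolyTime encode encodeBool fun x => decide (x ∈ L))

/-- The problem `C₁ → C₂` in its optimization form is solvable in polynomial time: a machine, given
any graph in `C₁`, outputs in polynomial time a minimum set of vertices whose deletion leaves a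
graph in `C₂`. -/
def MinDeletionInPolyTime (C₁ C₂ : GraphClass) : Prop :=
  ∃ f : (G : {G : FinGraph // C₁ G.2}) → Finset (Fin G.1.1),
    (∀ G, IsMinDeletionSet C₂ G.1.2 (f G)) ∧
    Nonempty (TM2ComputableInPolyTime (fun G : {G : FinGraph // C₁ G.2} => encodeGraph G.1)
      (id : List Bool → List Bool) (fun G => encodeVertexSet (f G)))

/-- The yes-instances of the problem `C₁ → C₂` in its decision form: pairs `(G, k)` such that `G` is
in `C₁` and can be made a graph in `C₂` by deleting at most `k` vertices. -/
def decisionProblem (C₁ C₂ : GraphClass) : Set (FinGraph × ℕ) :=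
  {x | C₁ x.1.2 ∧ ∃ S : Finset (Fin x.1.1), S.card ≤ x.2 ∧ IsDeletionSet C₂ x.1.2 S}

/-- The vertex deletion problem `C₁ → C₂` is in P, in its optimization form as well as in its
decision form. -/
def InP (C₁ C₂ : GraphClass) : Prop :=
  MinDeletionInPolyTime C₁ C₂ ∧ DecidableInPolyTime encodeGraphNat (decisionProblem C₁ C₂)

end VertexDeletion

/-! A graph is a cluster graph iff it has no induced path on three vertices. Let a split graph `G`
have clique `C` and independent set `I`. After a deletion that leaves a cluster graph, at most one
vertex of `I` can keep neighbours in the remaining clique, since two such vertices would yield an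
induced path, and a vertex that keeps one must be adjacent to the whole remaining clique. So guess
this vertex `v`. The clique vertices not adjacent to `v` are forced into the solution, and the
remaining edges between `C` and `I \ {v}` need a vertex cover. A guess `v ∈ C` stands for attaching
nothing. Both directions are `isDeletionSet_of_attach` and `exists_attach`; the problem becomes `n`
minimum vertex cover problems on bipartite graphs.

For the second problem, a split graph is complete split iff its complement is a cluster graph
(`isCompleteSplit_iff`). Complements of split graphs are split, and complementation commutes with
deletion, so the same algorithm runs on the complement.

Bipartite vertex covers come from an auction. An unmatched left vertex bids for a cheapest neighbour
of price below `n`, raises that price by one and displaces the previous owner. Prices are at most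
`n`, so their sum bounds the number of bids by `n * n`. At the end, a price level that is skipped
(there are `n + 1` levels and `n` prices) yields a cover with exactly one end of some matching edge
for each of its vertices and no matching edge used twice, hence a minimum one
(`IsAuction.exists_levelCover`). Every level gives a cover, so the algorithm tries all of them and
keeps the smallest solution.

A split partition is found by adding vertices one at a time. Two split partitions of the same graph
differ by at most one vertex in each direction, so trying all triples of changes suffices
(`SplitOn.exists_extend`).

For the Turing machine, the adjacency matrix is kept as a list of cells, and each entry carries
copies of the records of its row and of its column. Then one left-to-right sweep can update all
records, test whether some pair satisfies a predicate, or advance a loop mark, all with finite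
control. Operations obtained from such sweeps by composition and by loops over the indices run in
polynomial time (`Feasible.comp`, `Feasible.for`), and `Feasible.computable` turns them into
machines. The algorithm is written in these terms and verified with loop invariants. -/

namespace SweepMachine

/-! ### Steps of a stack machine -/

section Steps

variable {K : Type} [DecidableEq K] {Γ : K → Type} {Λ σ : Type}

/-- The machine `M` moves from `a` to `b` in exactly `t` steps. -/
def StepsIn (M : Λ → TM2.Stmt Γ Λ σ) (a b : TM2.Cfg Γ Λ σ) (t : ℕ) : Prop :=
  (flip bind (TM2.step M))^[t] (some a) = some b

theorem StepsIn.refl (M : Λ → TM2.Stmt Γ Λ σ) (a : TM2.Cfg Γ Λ σ) : StepsIn M a a 0 := rfl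

theorem StepsIn.trans {M : Λ → TM2.Stmt Γ Λ σ} {a b c : TM2.Cfg Γ Λ σ} {t u : ℕ}
    (h : StepsIn M a b t) (h' : StepsIn M b c u) : StepsIn M a c (t + u) := by
  unfold StepsIn at *
  rw [Nat.add_comm, Function.iterate_add_apply, h, h']

theorem StepsIn.head {M : Λ → TM2.Stmt Γ Λ σ} {a b c : TM2.Cfg Γ Λ σ} {t : ℕ}
    (h : TM2.step M a = some b) (h' : StepsIn M b c t) : StepsIn M a c (t + 1) := by
  unfold StepsIn at *
  rw [Function.iterate_add_apply]
  change (flip bind (TM2.step M))^[t] (TM2.step M a) = _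
  rw [h, h']

theorem StepsIn.single {M : Λ → TM2.Stmt Γ Λ σ} {a b : TM2.Cfg Γ Λ σ}
    (h : TM2.step M a = some b) : StepsIn M a b 1 :=
  StepsIn.head h (StepsIn.refl M b)

end Steps

/-! ### Programs that sweep over a list of cells -/

/-- Structured programs acting on a finite state `σ` and a list of cells. -/
inductive Cmd (σ C : Type) : Type
  | load (f : σ → σ)
  | sweep (f : σ → C → σ × C)
  | seq (p q : Cmd σ C)
  | loop (b : σ → Bool) (p : Cmd σ C)

variable {σ C : Type}

/-- Running a transducer over a list. -/
def sweepList (f : σ → C → σ × C) : σ → List C → σ × List C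
  | s, [] => (s, [])
  | s, c :: l => ((sweepList f (f s c).1 l).1, (f s c).2 :: (sweepList f (f s c).1 l).2)

theorem length_sweepList (f : σ → C → σ × C) (s : σ) (l : List C) :
    (sweepList f s l).2.length = l.length := by
  induction l generalizing s with
  | nil => rfl
  | cons c l ih => simp [sweepList, ih]

theorem sweepList_append (f : σ → C → σ × C) (s : σ) (l l' : List C) :
    sweepList f s (l ++ l') = ((sweepList f (sweepList f s l).1 l').1,
      (sweepList f s l).2 ++ (sweepList f (sweepList f s l).1 l').2) := by
  induction l generalizing s with
  | nil => rfl
  | cons c l ih => simp [sweepList, ih]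

/-- Big-step semantics, with the exact running time of the compiled program. -/
inductive Exec : Cmd σ C → σ × List C → σ × List C → ℕ → Prop
  | load (f s m) : Exec (.load f) (s, m) (f s, m) 1
  | sweep (f s m) : Exec (.sweep f) (s, m) (sweepList f s m) (2 * m.length + 2)
  | seq {p q a b c t u} : Exec p a b t → Exec q b c u → Exec (.seq p q) a c (t + u)
  | loop_done {b p a} : b a.1 = false → Exec (.loop b p) a a 1
  | loop_step {b p a a' a'' t u} : b a.1 = true → Exec p a a' t → Exec (.loop b p) a' a'' u →
      Exec (.loop b p) a a'' (t + u + 1)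

theorem Exec.length_eq {p : Cmd σ C} {a b : σ × List C} {t : ℕ} (h : Exec p a b t) :
    b.2.length = a.2.length := by
  induction h with
  | load | loop_done => rfl
  | sweep f s m => exact length_sweepList f s m
  | seq _ _ h h' => rw [h', h]
  | loop_step _ _ _ h h' => rw [h', h]

/-! ### Compilation -/

/-- The stacks: input, cells, cells in reverse, output. -/
inductive Stk : Type
  | input | cells | spare | output
  deriving DecidableEq

instance : Fintype Stk :=
  ⟨{.input, .cells, .spare, .output}, fun k => by cases k <;> decide⟩

/-- The alphabets of the stacks. -/
def Sym (C : Type) : Stk → Type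
  | .input => Γ'
  | .cells => C
  | .spare => C
  | .output => Bool

/-- The contents of the four stacks. -/
def stk (i : List Γ') (m a : List C) (o : List Bool) : ∀ k, List (Sym C k)
  | .input => i
  | .cells => m
  | .spare => a
  | .output => o

theorem cfg_ext {L τ : Type} {a b : TM2.Cfg (Sym C) L τ} (hl : a.l = b.l) (hv : a.var = b.var)
    (hs : ∀ k, a.stk k = b.stk k) : a = b := by
  cases a; cases b
  simp_all [funext_iff]

/-- The labels of a compiled program. -/
def Cmd.Label : Cmd σ C → Type
  | load _ => Unit
  | sweep _ => Bool
  | seq p q => p.Label ⊕ q.Label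
  | loop _ p => Option p.Label

/-- There are finitely many labels. -/
@[reducible]
def Cmd.fintypeLabel : (p : Cmd σ C) → Fintype p.Label
  | load _ => inferInstanceAs (Fintype Unit)
  | sweep _ => inferInstanceAs (Fintype Bool)
  | seq p q =>
    have := p.fintypeLabel
    have := q.fintypeLabel
    inferInstanceAs (Fintype (p.Label ⊕ q.Label))
  | loop _ p =>
    have := p.fintypeLabel
    inferInstanceAs (Fintype (Option p.Label))

/-- The label at which a compiled program starts. -/
def Cmd.entry : (p : Cmd σ C) → p.Label
  | load _ => ()
  | sweep _ => true
  | seq p _ => Sum.inl p.entry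
  | loop _ _ => none

/-- Statements of the machine: the state holds a buffer for a popped cell. -/
abbrev Code (σ C L : Type) : Type := TM2.Stmt (Sym C) L (σ × Option C)

open TM2.Stmt in
/-- Pop a cell and transform it by `f` onto the other stack; go to `exit` at the end. -/
def moveCode [Inhabited C] {L : Type} (src dst : Stk) (hs : Sym C src = C) (hd : C = Sym C dst)
    (f : σ → C → σ × C) (self exit : L) : Code σ C L :=
  pop src (fun s o => (s.1, o.map (cast hs)))
    (branch (fun s => s.2.isSome)
      (push dst (fun s => cast hd (s.2.elim default fun c => (f s.1 c).2))
        (load (fun s => (s.2.elim s.1 fun c => (f s.1 c).1, none)) (goto fun _ => self)))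
      (goto fun _ => exit))

open TM2.Stmt in
/-- The statements of a compiled program, its labels embedded by `emb`. -/
def Cmd.code [Inhabited C] {L : Type} :
    (p : Cmd σ C) → (emb : p.Label → L) → (exit : L) → p.Label → Code σ C L
  | .load f, _, exit, _ => .load (fun s => (f s.1, s.2)) (goto fun _ => exit)
  | .sweep f, emb, exit, l =>
    match (l : Bool) with
    | true => moveCode .cells .spare rfl rfl f (emb true) (emb false)
    | false => moveCode .spare .cells rfl rfl Prod.mk (emb false) exit
  | .seq p q, emb, exit, l =>
    match (l : p.Label ⊕ q.Label) with
    | .inl l => p.code (fun l => emb (Sum.inl l)) (emb (Sum.inr q.entry)) l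
    | .inr l => q.code (fun l => emb (Sum.inr l)) exit l
  | .loop b p, emb, exit, l =>
    match (l : Option p.Label) with
    | none => branch (fun s => b s.1) (goto fun _ => emb (some p.entry)) (goto fun _ => exit)
    | some l => p.code (fun l => emb (some l)) (emb none) l

section Correctness

variable [Inhabited C] {L : Type} {M : L → Code σ C L}

/-- A machine step runs a statement up to its jump, so each cell costs one step and the empty stack
one more. The cells arrive reversed on the other stack; the backward pass restores their order,
whence the time `2 * m.length + 2` of a sweep. -/
theorem stepsIn_forward {f : σ → C → σ × C} {self exit : L}
    (h : M self = moveCode .cells .spare rfl rfl f self exit) (i : List Γ') (o : List Bool) (s : σ)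
    (m a : List C) :
    StepsIn M ⟨some self, (s, none), stk i m a o⟩
      ⟨some exit, ((sweepList f s m).1, none), stk i [] ((sweepList f s m).2.reverse ++ a) o⟩
      (m.length + 1) := by
  induction m generalizing s a with
  | nil =>
    apply StepsIn.single
    rw [TM2.step, h]
    exact congrArg some (cfg_ext rfl rfl (by intro k; cases k <;> rfl))
  | cons c m ih =>
    refine StepsIn.head (b := ⟨some self, ((f s c).1, none), stk i m ((f s c).2 :: a) o⟩) ?_ ?_
    · rw [TM2.step, h]
      exact congrArg some (cfg_ext rfl rfl (by intro k; cases k <;> rfl))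
    · simpa [sweepList] using ih (f s c).1 ((f s c).2 :: a)

theorem stepsIn_backward {f : σ → C → σ × C} {self exit : L}
    (h : M self = moveCode .spare .cells rfl rfl f self exit) (i : List Γ') (o : List Bool) (s : σ)
    (m a : List C) :
    StepsIn M ⟨some self, (s, none), stk i m a o⟩
      ⟨some exit, ((sweepList f s a).1, none), stk i ((sweepList f s a).2.reverse ++ m) [] o⟩
      (a.length + 1) := by
  induction a generalizing s m with
  | nil =>
    apply StepsIn.single
    rw [TM2.step, h]
    exact congrArg some (cfg_ext rfl rfl (by intro k; cases k <;> rfl))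
  | cons c a ih =>
    refine StepsIn.head (b := ⟨some self, ((f s c).1, none), stk i ((f s c).2 :: m) a o⟩) ?_ ?_
    · rw [TM2.step, h]
      exact congrArg some (cfg_ext rfl rfl (by intro k; cases k <;> rfl))
    · simpa [sweepList] using ih (f s c).1 ((f s c).2 :: m)

omit [Inhabited C] in
theorem sweepList_mk (s : σ) (l : List C) : sweepList Prod.mk s l = (s, l) := by
  induction l with
  | nil => rfl
  | cons c l ih => simp [sweepList, ih]

/-- The induction is on the execution and not on the program, so a loop unfolds one iteration at a
time. The embedding `emb` and the label `exit` vary, because a subprogram lives inside a larger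
machine and leaves to a label of its context. -/
theorem stepsIn_of_exec {p : Cmd σ C} {a b : σ × List C} {t : ℕ} (h : Exec p a b t)
    (emb : p.Label → L) (exit : L) (hM : ∀ l, M (emb l) = p.code emb exit l) (i : List Γ')
    (o : List Bool) :
    StepsIn M ⟨some (emb p.entry), (a.1, none), stk i a.2 [] o⟩
      ⟨some exit, (b.1, none), stk i b.2 [] o⟩ t := by
  induction h generalizing exit with
  | load f s m =>
    apply StepsIn.single
    rw [TM2.step, hM]
    rfl
  | sweep f s m =>
    have h₁ := stepsIn_forward (hM true) i o s m []
    have h₂ := stepsIn_backward (hM false) i o (sweepList f s m).1 [] (sweepList f s m).2.reverse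
    rw [sweepList_mk] at h₂
    simp only [List.append_nil, List.length_reverse, List.reverse_reverse, length_sweepList]
      at h₁ h₂
    have h₃ := h₁.trans h₂
    rwa [show m.length + 1 + (m.length + 1) = 2 * m.length + 2 by ring] at h₃
  | @seq p q a b c t u _ _ ih ih' =>
    exact (ih (fun l => emb (Sum.inl l)) (emb (Sum.inr q.entry)) fun l => hM (Sum.inl l)).trans
      (ih' (fun l => emb (Sum.inr l)) exit fun l => hM (Sum.inr l))
  | @loop_done b p a hb =>
    apply StepsIn.single
    rw [TM2.step, hM]
    simp [Cmd.code, Cmd.entry, hb]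
  | @loop_step b p a a' a'' t u hb _ _ ih ih' =>
    refine StepsIn.head (b := ⟨some (emb (some p.entry)), (a.1, none), stk i a.2 [] o⟩) ?_
      ((ih (fun l => emb (some l)) (emb none) fun l => hM (some l)).trans (ih' emb exit hM))
    rw [TM2.step, hM]
    simp [Cmd.code, Cmd.entry, hb]

end Correctness

/-! ### Boolean matrix states -/

/-- The cells that store a matrix: an entry, together with copies of the records of its row and of
its column; the end of a row; a digit of a binary number. -/
inductive Cell (S A : Type) : Type
  | data (row col : S) (a : A)
  | sep
  | num (b : Bool)
  deriving Fintype

instance (S A : Type) : Inhabited (Cell S A) := ⟨.sep⟩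

/-- A state on `n` indices: a finite record of flags, a record for each index, a record for each
pair of indices, and a binary number. -/
structure MState (F S A : Type) (n : ℕ) : Type where
  fl : F
  st : Fin n → S
  ar : Fin n → Fin n → A
  num : List Bool

/-- Transformations of states, uniform in the number of indices. -/
abbrev Op (F S A : Type) : Type := ∀ n : ℕ, MState F S A n → MState F S A n

variable {F S A : Type}

/-- A matrix, row by row. -/
def rows {n : ℕ} (d : Fin n → Fin n → Cell S A) : List (Cell S A) :=
  (List.finRange n).flatMap fun i => (List.finRange n).map (d i) ++ [.sep]

/-- The list of cells that stores a state. -/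
def MState.cells {n : ℕ} (h : MState F S A n) : List (Cell S A) :=
  rows (fun i j => .data (h.st i) (h.st j) (h.ar i j)) ++ h.num.map .num

theorem length_rows {n : ℕ} (d : Fin n → Fin n → Cell S A) : (rows d).length = n * (n + 1) := by
  simp [rows, List.length_flatMap]

theorem MState.le_length_cells {n : ℕ} (h : MState F S A n) : n ≤ h.cells.length := by
  simp only [cells, List.length_append, length_rows]
  nlinarith [Nat.zero_le (n * n)]

/-- Scratch bits of a sweep. -/
structure Scratch : Type where
  (go row cur col : Bool)
  deriving Fintype

/-- Scratch bits that carry one bit of information. -/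
def Scratch.flag (b : Bool) : Scratch := ⟨b, false, false, false⟩

/-- The initial scratch bits. -/
def Scratch.reset : Scratch := .flag false

/-- The control state of a program. -/
abbrev Ctl (F : Type) : Type := F × Scratch

section Sweeps

variable {σ C : Type} {f : σ → C → σ × C}

theorem sweepList_map_finRange {n : ℕ} (s : ℕ → σ) (c c' : Fin n → C)
    (h : ∀ i : Fin n, f (s i) (c i) = (s (i + 1), c' i)) :
    sweepList f (s 0) ((List.finRange n).map c) = (s n, (List.finRange n).map c') := by
  induction n generalizing s with
  | zero => rfl
  | succ n ih =>
    have h₀ := h 0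
    have h₁ := ih (fun i => s (i + 1)) (fun i => c i.succ) (fun i => c' i.succ)
      fun i => by simpa using h i.succ
    simp only [Fin.val_zero, Nat.zero_add] at h₀ h₁
    simp only [List.finRange_succ, List.map_cons, List.map_map, sweepList, h₀]
    simp only [Function.comp_def, h₁]

theorem sweepList_flatMap_finRange {n : ℕ} (s : ℕ → σ) (c c' : Fin n → List C)
    (h : ∀ i : Fin n, sweepList f (s i) (c i) = (s (i + 1), c' i)) :
    sweepList f (s 0) ((List.finRange n).flatMap c) = (s n, (List.finRange n).flatMap c') := by
  induction n generalizing s with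
  | zero => rfl
  | succ n ih =>
    have h₀ := h 0
    have h₁ := ih (fun i => s (i + 1)) (fun i => c i.succ) (fun i => c' i.succ)
      fun i => by simpa using h i.succ
    simp only [Fin.val_zero, Nat.zero_add] at h₀ h₁
    simp only [List.finRange_succ, List.flatMap_cons, List.flatMap_map, sweepList_append, h₀, h₁]

/-- Here `s i j` is the control state just before entry `(i, j)`, and `s i n` the one just before
the separator of row `i`. Giving this function in closed form replaces an induction for each
transducer. -/
theorem sweepList_rows {f : σ → Cell S A → σ × Cell S A} {n : ℕ} (s : ℕ → ℕ → σ)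
    (d d' : Fin n → Fin n → Cell S A)
    (h : ∀ i j : Fin n, f (s i j) (d i j) = (s i (j + 1), d' i j))
    (h' : ∀ i : Fin n, f (s i n) .sep = (s (i + 1) 0, .sep)) :
    sweepList f (s 0 0) (rows d) = (s n 0, rows d') := by
  refine sweepList_flatMap_finRange (fun i => s i 0) _ _ fun i => ?_
  simp only [sweepList_append, sweepList_map_finRange (s i) (d i) (d' i) (h i), sweepList, h']

theorem sweepList_const {f : σ → C → σ × C} {s : σ} {l : List C}
    (h : ∀ c ∈ l, f s c = (s, c)) : sweepList f s l = (s, l) := by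
  induction l with
  | nil => rfl
  | cons c l ih =>
    rw [List.forall_mem_cons] at h
    simp [sweepList, h.1, ih h.2]

theorem sweepList_num {f : σ → Cell S A → σ × Cell S A} (s : σ)
    (h : ∀ b, f s (.num b) = (s, .num b)) (l : List Bool) :
    sweepList f s (l.map .num) = (s, l.map .num) :=
  sweepList_const fun c hc => by
    obtain ⟨b, -, rfl⟩ := List.mem_map.1 hc
    exact h b

theorem sweepList_cells {f : σ → Cell S A → σ × Cell S A} {n : ℕ} {h h' : MState F S A n}
    (s : ℕ → ℕ → σ) {s₀ s₁ : σ} (h₀ : s₀ = s 0 0) (h₁ : s₁ = s n 0)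
    (hd : ∀ i j : Fin n, f (s i j) (.data (h.st i) (h.st j) (h.ar i j)) =
      (s i (j + 1), .data (h'.st i) (h'.st j) (h'.ar i j)))
    (hs : ∀ i : Fin n, f (s i n) .sep = (s (i + 1) 0, .sep))
    (hn : ∀ b, f s₁ (.num b) = (s₁, .num b)) (hh : h'.num = h.num) :
    sweepList f s₀ h.cells = (s₁, h'.cells) := by
  rw [MState.cells, sweepList_append, h₀, sweepList_rows s _ _ hd hs]
  simp only
  rw [← h₁, sweepList_num _ hn, MState.cells, hh]

end Sweeps

/-! ### Operations that programs carry out in polynomial time -/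

/-- The program `p` carries out `φ` in time `P` of the number of cells. -/
def Performs (p : Cmd (Ctl F) (Cell S A)) (P : Polynomial ℕ) (φ : Op F S A) : Prop :=
  ∀ n (h : MState F S A n), ∃ t ≤ P.eval h.cells.length,
    Exec p ((h.fl, .reset), h.cells) (((φ n h).fl, .reset), (φ n h).cells) t

/-- The operation `φ` can be carried out in polynomial time. -/
def Feasible (φ : Op F S A) : Prop := ∃ p P, Performs p P φ

theorem Performs.comp {p q : Cmd (Ctl F) (Cell S A)} {P Q : Polynomial ℕ} {φ ψ : Op F S A}
    (hφ : Performs p P φ) (hψ : Performs q Q ψ) :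
    Performs (.seq p q) (P + Q) fun n h => ψ n (φ n h) := by
  intro n h
  obtain ⟨t, ht, h₁⟩ := hφ n h
  obtain ⟨u, hu, h₂⟩ := hψ n (φ n h)
  refine ⟨t + u, ?_, h₁.seq h₂⟩
  have hl : (φ n h).cells.length = h.cells.length := h₁.length_eq
  rw [hl] at hu
  simpa using Nat.add_le_add ht hu

theorem Feasible.comp {φ ψ : Op F S A} (hψ : Feasible ψ) (hφ : Feasible φ) :
    Feasible fun n h => ψ n (φ n h) := by
  obtain ⟨p, P, hp⟩ := hφ
  obtain ⟨q, Q, hq⟩ := hψ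
  exact ⟨_, _, hp.comp hq⟩

/-- A sweep between two instructions on the control state, and its time. -/
theorem performs_sweep (ini : Ctl F → Ctl F) (f : Ctl F → Cell S A → Ctl F × Cell S A)
    (fin : Ctl F → Ctl F) (c : Ctl F) (m : List (Cell S A)) :
    Exec (.seq (.load ini) (.seq (.sweep f) (.load fin))) (c, m)
      (fin (sweepList f (ini c) m).1, (sweepList f (ini c) m).2) (2 * m.length + 4) := by
  have := (Exec.load ini c m).seq ((Exec.sweep f (ini c) m).seq
    (Exec.load fin (sweepList f (ini c) m).1 (sweepList f (ini c) m).2))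
  rwa [show 1 + (2 * m.length + 2 + 1) = 2 * m.length + 4 by ring] at this

/-- The state `s` reached by the sweep may contain arbitrary scratch bits; `fin` has to evaluate and
reset them. -/
theorem Feasible.of_sweep {φ : Op F S A} (ini : Ctl F → Ctl F)
    (f : Ctl F → Cell S A → Ctl F × Cell S A) (fin : Ctl F → Ctl F)
    (H : ∀ n (h : MState F S A n), ∃ s, sweepList f (ini (h.fl, .reset)) h.cells =
      (s, (φ n h).cells) ∧ fin s = ((φ n h).fl, .reset)) :
    Feasible φ := by
  refine ⟨.seq (.load ini) (.seq (.sweep f) (.load fin)), 2 * Polynomial.X + 4,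
    fun n h => ⟨2 * h.cells.length + 4, ?_, ?_⟩⟩
  · simp
  · obtain ⟨s, hs, hs'⟩ := H n h
    have := performs_sweep ini f fin (h.fl, .reset) h.cells
    rwa [hs, hs'] at this

/-- Change all records at once. -/
def mapOp (g : F → S → S) (k : F → S → S → A → A) : Op F S A := fun _ h =>
  { h with
    st := fun i => g h.fl (h.st i)
    ar := fun i j => k h.fl (h.st i) (h.st j) (h.ar i j) }

theorem feasible_map (g : F → S → S) (k : F → S → S → A → A) : Feasible (mapOp g k) :=
  Feasible.of_sweep id
    (fun s c => match c with
      | .data r c a => (s, .data (g s.1 r) (g s.1 c) (k s.1 r c a))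
      | c => (s, c)) id fun _ h =>
    ⟨(h.fl, .reset), sweepList_cells (fun _ _ => (h.fl, .reset)) rfl rfl (fun _ _ => rfl)
      (fun _ => rfl) (fun _ => rfl) rfl, rfl⟩

/-- Change the flags according to whether some pair of indices satisfies `p`. -/
def queryOp (p : F → S → S → A → Bool) (u : F → Bool → F) : Op F S A := fun _ h =>
  { h with fl := u h.fl (decide (∃ i j, p h.fl (h.st i) (h.st j) (h.ar i j) = true)) }

theorem sweepList_any {q : F → Cell S A → Bool} (s : F) (b : Bool) (l : List (Cell S A)) :
    sweepList (fun (s : Ctl F) c => ((s.1, .flag (s.2.go || q s.1 c)), c)) (s, .flag b) l =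
      ((s, .flag (b || l.any (q s))), l) := by
  induction l generalizing b with
  | nil => simp [sweepList]
  | cons c l ih =>
    rw [sweepList, ih]
    simp [Scratch.flag, Bool.or_assoc]

/-- The predicate `p` on the cells that store entries. -/
def Cell.sat (p : S → S → A → Bool) : Cell S A → Bool
  | .data r c a => p r c a
  | _ => false

theorem feasible_query (p : F → S → S → A → Bool) (u : F → Bool → F) :
    Feasible (queryOp p u) := by
  refine Feasible.of_sweep id
    (fun s c => ((s.1, .flag (s.2.go || c.sat (p s.1))), c)) (fun s => (u s.1 s.2.go, .reset))
    fun n h => ⟨_, sweepList_any (q := fun s c => c.sat (p s)) h.fl false h.cells, ?_⟩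
  simp only [queryOp, Prod.mk.injEq, and_true, Bool.false_or]
  refine congrArg _ ?_
  simp only [Scratch.flag]
  rw [Bool.eq_iff_iff, List.any_eq_true, decide_eq_true_iff]
  simp only [MState.cells, rows, List.mem_append, List.mem_flatMap, List.mem_map,
    List.mem_finRange, true_and, List.mem_singleton]
  constructor
  · rintro ⟨x, ⟨i, ⟨j, rfl⟩ | rfl⟩ | ⟨b, _, rfl⟩, hx⟩
    · exact ⟨i, j, hx⟩
    · cases hx
    · cases hx
  · rintro ⟨i, j, hx⟩
    exact ⟨_, Or.inl ⟨i, Or.inl ⟨j, rfl⟩⟩, hx⟩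

/-- Subtract a borrow from a binary number, least significant digit first. -/
def borrow : Bool → List Bool → Bool × List Bool
  | b, [] => (b, [])
  | b, d :: l => ((borrow (b && !d) l).1, (b ^^ d) :: (borrow (b && !d) l).2)

/-- Decrement the number if `p` holds, and pass to the flags whether it was zero. -/
def decOp (p : F → Bool) (u : F → Bool → F) : Op F S A := fun _ h =>
  { h with
    fl := u h.fl (borrow (p h.fl) h.num).1
    num := (borrow (p h.fl) h.num).2 }

/-- The transducer that subtracts a borrow. -/
def borrowCell (s : Ctl F) : Cell S A → Ctl F × Cell S A
  | .num d => ((s.1, .flag (s.2.go && !d)), .num (s.2.go ^^ d))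
  | c => (s, c)

theorem sweepList_borrowCell (s : F) (b : Bool) (l : List Bool) :
    sweepList (borrowCell (S := S) (A := A)) (s, .flag b) (l.map .num) =
      ((s, .flag (borrow b l).1), (borrow b l).2.map .num) := by
  induction l generalizing b with
  | nil => rfl
  | cons d l ih =>
    rw [List.map_cons, sweepList, borrowCell]
    simp only
    rw [show (Scratch.flag b).go = b from rfl, ih]
    rfl

/-- The digits follow the matrix, least significant first, so the borrow travels in the direction of
the sweep; the matrix cells leave it unchanged. -/
theorem feasible_dec (p : F → Bool) (u : F → Bool → F) :
    Feasible (decOp (S := S) (A := A) p u) := by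
  refine Feasible.of_sweep (fun s => (s.1, .flag (p s.1))) borrowCell
    (fun s => (u s.1 s.2.go, .reset))
    fun n h => ⟨(h.fl, .flag (borrow (p h.fl) h.num).1), ?_, rfl⟩
  rw [MState.cells, sweepList_append,
    sweepList_rows (s := fun _ _ => (h.fl, .flag (p h.fl))) (f := borrowCell)
    (d := fun i j => .data (h.st i) (h.st j) (h.ar i j))
    (d' := fun i j => .data (h.st i) (h.st j) (h.ar i j))
    (fun _ _ => rfl) (fun _ => rfl)]
  simp only [sweepList_borrowCell]
  rfl

/-! ### Loops over the indices -/

/-- A boolean field of the records of indices. -/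
structure BitField (S : Type) : Type where
  get : S → Bool
  set : Bool → S → S
  get_set : ∀ b s, get (set b s) = b

/-- Set a field at all indices. -/
def MState.setField {n : ℕ} (h : MState F S A n) (x : BitField S) (v : Fin n → Bool) :
    MState F S A n :=
  { h with st := fun i => x.set (v i) (h.st i) }

/-- The indicator function of an index. -/
def single {n : ℕ} (a : ℕ) : Fin n → Bool := fun i => decide (i.val = a)

/-- For each index `i` in order, mark `i` in the field `x` and perform `φ`. -/
def forOp (x : BitField S) (φ : Op F S A) : Op F S A := fun n h =>
  ((List.finRange n).foldl (fun h (i : Fin n) => φ n (h.setField x (single i))) h).setField x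
    fun _ => false

/-- The transducer that marks the index `0`. -/
def firstCell (x : BitField S) (s : Ctl F) : Cell S A → Ctl F × Cell S A
  | .data r c a => ((s.1, ⟨true, s.2.row, s.2.cur, false⟩),
      .data (x.set s.2.row r) (x.set s.2.col c) a)
  | .sep => ((s.1, ⟨s.2.go, false, s.2.cur, true⟩), .sep)
  | c => (s, c)

/-- The transducer that moves the mark to the next index. -/
def nextCell (x : BitField S) (s : Ctl F) : Cell S A → Ctl F × Cell S A
  | .data r c a => ((s.1, ⟨s.2.go || s.2.row, s.2.row, x.get r, x.get c⟩),
      .data (x.set s.2.row r) (x.set s.2.col c) a)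
  | .sep => ((s.1, ⟨s.2.go, s.2.cur, false, false⟩), .sep)
  | c => (s, c)

/-- The scratch bits `row` and `col` say whether the current row and column are the first ones. The
bit `go` records that some entry was seen, that is, that the loop has an index to start with. -/
theorem exec_first (x : BitField S) {n : ℕ} (h : MState F S A n) :
    Exec (.seq (.load fun s => (s.1, ⟨false, true, false, true⟩))
        (.seq (.sweep (firstCell x)) (.load fun s => (s.1, .flag s.2.go))))
      ((h.fl, .reset), h.cells)
      ((h.fl, .flag (decide (0 < n))), (h.setField x (single 0)).cells)
      (2 * h.cells.length + 4) := by
  have key : sweepList (firstCell x) (h.fl, ⟨false, true, false, true⟩) h.cells =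
      ((h.fl, ⟨decide (0 < n), decide (n = 0), false, true⟩),
        (h.setField x (single 0)).cells) := by
    refine sweepList_cells
      (fun i j => (h.fl, ⟨decide (0 < i ∨ 0 < j), decide (i = 0), false, decide (j = 0)⟩))
      (by simp) (by simp) (fun i j => ?_) (fun i => ?_) (fun _ => rfl) rfl
    · simp [firstCell, single, MState.setField]
    · simp [firstCell, i.pos]
  have := performs_sweep (fun s => (s.1, ⟨false, true, false, true⟩)) (firstCell (A := A) x)
    (fun s => (s.1, .flag s.2.go)) (h.fl, .reset) h.cells
  simpa only [key] using this

/-- The bit `col` delays the old column mark by one cell. The bit `cur` remembers the old mark of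
the current row and is handed to `row` at the separator. The bit `go` becomes true iff some row
receives the mark, which decides whether the loop continues. -/
theorem exec_next (x : BitField S) {n : ℕ} (h : MState F S A n) {a : ℕ}
    (hx : ∀ i, x.get (h.st i) = single a i) :
    Exec (.seq (.load id) (.seq (.sweep (nextCell x)) (.load fun s => (s.1, .flag s.2.go))))
      ((h.fl, .reset), h.cells)
      ((h.fl, .flag (decide (a + 1 < n))), (h.setField x (single (a + 1))).cells)
      (2 * h.cells.length + 4) := by
  have key : sweepList (nextCell x) (h.fl, .reset) h.cells =
      ((h.fl, ⟨decide (a + 1 < n), decide (n = a + 1), false, false⟩),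
        (h.setField x (single (a + 1))).cells) := by
    refine sweepList_cells
      (fun i j => (h.fl, ⟨decide (a + 1 < i ∨ a + 1 = i ∧ 0 < j), decide (i = a + 1),
        decide (0 < j ∧ i = a), decide (j = a + 1)⟩))
      (by simp [Scratch.reset, Scratch.flag]) (by simp) (fun i j => ?_) (fun i => ?_)
      (fun _ => rfl) rfl
    · simp only [nextCell, hx, single, MState.setField, Prod.mk.injEq, Scratch.mk.injEq, true_and,
        and_true]
      refine ⟨?_, by simp, by simp⟩
      rw [Bool.eq_iff_iff]
      simp
      omega
    · have := i.pos
      simp only [nextCell, Prod.mk.injEq, Scratch.mk.injEq, true_and, and_true]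
      refine ⟨?_, ?_, ?_, ?_⟩ <;> rw [Bool.eq_iff_iff] <;> simp <;> omega
  have := performs_sweep id (nextCell (A := A) x)
    (fun s => (s.1, .flag s.2.go)) (h.fl, .reset) h.cells
  simpa only [id, key] using this

/-- The loop counter is the mark in the field `x`, so the body must preserve that field. The number
of iterations is `n`, which is at most the number of cells; hence the time remains polynomial. -/
theorem Feasible.for {φ : Op F S A} (x : BitField S) (hφ : Feasible φ)
    (hx : ∀ n (h : MState F S A n) i, x.get ((φ n h).st i) = x.get (h.st i)) :
    Feasible (forOp x φ) := by
  obtain ⟨p, P, hp⟩ := hφ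
  let body : Cmd (Ctl F) (Cell S A) := .seq (.load fun s => (s.1, .reset)) (.seq p
    (.seq (.load id) (.seq (.sweep (nextCell x)) (.load fun s => (s.1, .flag s.2.go)))))
  have loop : ∀ n (N d a : ℕ) (h : MState F S A n), h.cells.length = N → a + d = n →
      ∃ t ≤ d * (P.eval N + 2 * N + 6) + 1,
        Exec (.loop (fun s => s.2.go) body)
          ((h.fl, .flag (decide (a < n))), (h.setField x (single a)).cells)
          (((((List.finRange n).drop a).foldl
            (fun h (i : Fin n) => φ n (h.setField x (single i))) h).fl,
            .reset),
            ((((List.finRange n).drop a).foldl (fun h (i : Fin n) => φ n (h.setField x (single i)))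
              h).setField x fun _ => false).cells) t := by
    intro n N d
    induction d with
    | zero =>
      intro a h _ ha
      obtain rfl : a = n := by omega
      refine ⟨1, by simp, ?_⟩
      -- After the last index the mark has left the matrix, which is the cleared field at the end of
      -- `forOp`.
      have hs : (single a : Fin a → Bool) = fun _ => false := by
        funext i; simp [single, i.isLt.ne]
      have : (List.finRange a).drop a = [] := by simp
      rw [this, hs]
      simp only [Nat.lt_irrefl, decide_false, List.foldl_nil]
      exact Exec.loop_done rfl
    | succ d ih =>
      intro a h hN ha
      have han : a < n := by omega
      have hN' : (h.setField x (single a)).cells.length = N := by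
        rw [← hN]
        simp [MState.cells, length_rows, MState.setField]
      obtain ⟨t, ht, h₁⟩ := hp n (h.setField x (single a))
      have hN'' : (φ n (h.setField x (single a))).cells.length = N := h₁.length_eq.trans hN'
      have h₂ := exec_next x (φ n (h.setField x (single a))) (a := a) fun i => by
        rw [hx]
        exact x.get_set _ _
      obtain ⟨u, hu, h₃⟩ := ih (a + 1) (φ n (h.setField x (single a))) hN'' (by omega)
      have hd : (List.finRange n).drop a = ⟨a, han⟩ :: (List.finRange n).drop (a + 1) := by
        rw [List.drop_eq_getElem_cons (by simpa using han)]
        simp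
      rw [hd, List.foldl_cons]
      refine ⟨_, ?_, Exec.loop_step (decide_eq_true han)
        ((Exec.load (fun s => (s.1, Scratch.reset)) _ _).seq (h₁.seq h₂)) h₃⟩
      rw [hN'']
      rw [hN'] at ht
      -- An iteration costs one step for the loop test, one for resetting the scratch bits, at most
      -- `P.eval N` for the body, and `2 * N + 4` for moving the mark.
      have : (d + 1) * (P.eval N + 2 * N + 6) =
        d * (P.eval N + 2 * N + 6) + (P.eval N + 2 * N + 6) := by ring
      omega
  refine ⟨.seq (.seq (.load fun s => (s.1, ⟨false, true, false, true⟩))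
      (.seq (.sweep (firstCell x)) (.load fun s => (s.1, .flag s.2.go))))
      (.loop (fun s => s.2.go) body),
    (2 * Polynomial.X + 4) + (Polynomial.X * (P + 2 * Polynomial.X + 6) + 1), fun n h => ?_⟩
  obtain ⟨t, ht, h₁⟩ := loop n h.cells.length n 0 h rfl (by omega)
  refine ⟨_, ?_, (exec_first x h).seq h₁⟩
  have : n * (P.eval h.cells.length + 2 * h.cells.length + 6) ≤
      h.cells.length * (P.eval h.cells.length + 2 * h.cells.length + 6) :=
    Nat.mul_le_mul_right _ h.le_length_cells
  simp only [Polynomial.eval_add, Polynomial.eval_mul, Polynomial.eval_X, Polynomial.eval_one,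
    Polynomial.eval_ofNat]
  omega

/-! ### Machines for functions on boolean matrices -/

/-- A boolean matrix, a comma ending each row, followed by a list of bits. -/
def matrixWord {n : ℕ} (m : Fin n → Fin n → Bool) (l : List Bool) : List Γ' :=
  ((List.finRange n).flatMap fun i => (List.finRange n).map (fun j => Γ'.bit (m i j)) ++
    [Γ'.comma]) ++ l.map Γ'.bit

/-- How matrices are read into the initial state: the initial records, with a bit stored in the
records of entries. -/
structure Input (F S A : Type) : Type where
  fl : F
  st : S
  ar : Bool → A
  bit : A → Bool
  bit_ar : ∀ b, bit (ar b) = b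

/-- The initial state for a matrix and a list of bits. -/
def Input.state (I : Input F S A) {n : ℕ} (m : Fin n → Fin n → Bool) (l : List Bool) :
    MState F S A n :=
  ⟨I.fl, fun _ => I.st, fun i j => I.ar (m i j), l⟩

/-- How an output word is read off the final state: at most one bit from each cell, preceded by at
most one bit from the flags. -/
structure Output (F S A : Type) : Type where
  bit : Cell S A → Option Bool
  first : F → Option Bool

/-- The output word of a final state. -/
def Output.word (O : Output F S A) {n : ℕ} (h : MState F S A n) : List Bool :=
  (O.first h.fl).toList ++ h.cells.filterMap O.bit

/-- The cell of an input symbol. -/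
def Input.cell (I : Input F S A) : Γ' → Cell S A
  | .bit b => .data I.st I.st (I.ar b)
  | _ => .sep

/-- The transducer that, from the end, turns the cells after the last separator into digits. -/
def Input.mark (I : Input F S A) (s : Ctl F) : Cell S A → Ctl F × Cell S A
  | .data r c a => if s.2.go then (s, .data r c a) else (s, .num (I.bit a))
  | .sep => ((s.1, .flag true), .sep)
  | .num b => (s, .num b)

theorem map_cell_matrixWord (I : Input F S A) {n : ℕ} (m : Fin n → Fin n → Bool)
    (l : List Bool) : (matrixWord m l).map I.cell =
      rows (fun i j => .data I.st I.st (I.ar (m i j))) ++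
        l.map fun b => .data I.st I.st (I.ar b) := by
  simp [matrixWord, rows, List.map_flatMap, Function.comp_def, Input.cell]

theorem rows_eq_nil_or {n : ℕ} (d : Fin n → Fin n → Cell S A) :
    rows d = [] ∨ ∃ l, rows d = l ++ [.sep] := by
  have key : ∀ (g : Fin n → List (Cell S A)) (l : List (Fin n)),
      l.flatMap (fun i => g i ++ [.sep]) = [] ∨
        ∃ r, l.flatMap (fun i => g i ++ [.sep]) = r ++ [.sep] := by
    intro g l
    rcases List.eq_nil_or_concat l with rfl | ⟨l, i, rfl⟩
    · exact Or.inl rfl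
    · exact Or.inr ⟨l.flatMap (fun i => g i ++ [.sep]) ++ g i, by simp⟩
  exact key _ _

/-- Matrix entries and digits are both read as bits. Only the last comma separates them, so they are
told apart while the reversed list is unloaded from its end. -/
theorem sweepList_mark (I : Input F S A) {n : ℕ} (m : Fin n → Fin n → Bool) (l : List Bool) :
    ∃ b, sweepList I.mark (I.fl, .reset) ((matrixWord m l).map I.cell).reverse =
      ((I.fl, .flag b), (I.state m l).cells.reverse) := by
  rw [map_cell_matrixWord, List.reverse_append, sweepList_append]
  have h₁ : ∀ l : List Bool, sweepList I.mark (I.fl, .reset)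
      (l.map fun b => .data I.st I.st (I.ar b)) = ((I.fl, .reset), l.map .num) := by
    intro l
    induction l with
    | nil => rfl
    | cons b l ih =>
      have : I.mark (I.fl, .reset) (.data I.st I.st (I.ar b)) = ((I.fl, .reset), .num b) := by
        simp [Input.mark, Scratch.reset, Scratch.flag, I.bit_ar]
      simp [sweepList, this, ih]
  have h₂ : ∀ l : List (Cell S A), sweepList I.mark (I.fl, .flag true) l =
      ((I.fl, .flag true), l) := fun l => sweepList_const fun c _ => by
    cases c <;> rfl
  rw [← List.map_reverse, h₁]
  simp only [MState.cells, List.reverse_append, ← List.map_reverse]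
  -- For `n = 0` there is no comma and the scratch bit stays false; therefore the final bit is only
  -- claimed to exist.
  rcases rows_eq_nil_or fun i j => (.data I.st I.st (I.ar (m i j)) : Cell S A) with h | ⟨r, h⟩
  · refine ⟨false, ?_⟩
    simp only [Input.state, h]
    rfl
  · refine ⟨true, ?_⟩
    simp only [Input.state, h, List.reverse_append, List.reverse_singleton, List.singleton_append]
    rw [sweepList, Input.mark]
    simp only [h₂]

/-- The phases before and after the run of a program. -/
inductive Phase : Type
  | read | mark | unload | emit
  deriving DecidableEq

instance : Fintype Phase :=
  ⟨{.read, .mark, .unload, .emit}, fun k => by cases k <;> decide⟩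

open TM2.Stmt in
/-- Read the input into cells, in reverse. -/
def readCode {L : Type} (I : Input F S A) (self exit : L) : Code (Ctl F) (Cell S A) L :=
  pop .input (fun s (o : Option Γ') => (s.1, o.map I.cell))
    (branch (fun s => s.2.isSome)
      (push .spare (fun s => (s.2.getD .sep : Cell S A))
        (load (fun s => (s.1, none)) (goto fun _ => self)))
      (goto fun _ => exit))

open TM2.Stmt in
/-- Write the output, and halt. -/
def emitCode {L : Type} (I : Input F S A) (O : Output F S A) (self : L) :
    Code (Ctl F) (Cell S A) L :=
  pop .spare (fun s (o : Option (Cell S A)) => (s.1, o))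
    (branch (fun s => s.2.isSome)
      (branch (fun s => (s.2.bind O.bit).isSome)
        (push .output (fun s => ((s.2.bind O.bit).getD false : Bool))
          (load (fun s => (s.1, none)) (goto fun _ => self)))
        (load (fun s => (s.1, none)) (goto fun _ => self)))
      (branch (fun s => (O.first s.1.1).isSome)
        (push .output (fun s => ((O.first s.1.1).getD false : Bool))
          (load (fun _ => ((I.fl, .reset), none)) halt))
        (load (fun _ => ((I.fl, .reset), none)) halt)))

/-- The machine that runs `p` between reading the input and writing the output. -/
def program (I : Input F S A) (O : Output F S A) (p : Cmd (Ctl F) (Cell S A)) :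
    p.Label ⊕ Phase → Code (Ctl F) (Cell S A) (p.Label ⊕ Phase)
  | .inl l => p.code Sum.inl (.inr .unload) l
  | .inr .read => readCode I (.inr .read) (.inr .mark)
  | .inr .mark => moveCode .spare .cells rfl rfl I.mark (.inr .mark) (.inl p.entry)
  | .inr .unload => moveCode .cells .spare rfl rfl Prod.mk (.inr .unload) (.inr .emit)
  | .inr .emit => emitCode I O (.inr .emit)

section Correctness

variable {L : Type} {M : L → Code (Ctl F) (Cell S A) L} {I : Input F S A} {O : Output F S A}

theorem stepsIn_read {self exit : L} (h : M self = readCode I self exit) (s : Ctl F)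
    (w : List Γ') (a : List (Cell S A)) :
    StepsIn M ⟨some self, (s, none), stk w [] a []⟩
      ⟨some exit, (s, none), stk [] [] ((w.map I.cell).reverse ++ a) []⟩ (w.length + 1) := by
  induction w generalizing a with
  | nil =>
    apply StepsIn.single
    rw [TM2.step, h]
    exact congrArg some (cfg_ext rfl rfl (by intro k; cases k <;> rfl))
  | cons c w ih =>
    refine StepsIn.head (b := ⟨some self, (s, none), stk w [] (I.cell c :: a) []⟩) ?_ ?_
    · rw [TM2.step, h]
      exact congrArg some (cfg_ext rfl rfl (by intro k; cases k <;> rfl))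
    · simpa using ih (I.cell c :: a)

/-- The cells are popped last to first, so pushing their bits builds the output in the right order,
with the bit of the flags on top. The control state is reset because `haltList` asks for the initial
one. -/
theorem stepsIn_emit {self : L} (h : M self = emitCode I O self) (s : Ctl F)
    (a : List (Cell S A)) (o : List Bool) :
    StepsIn M ⟨some self, (s, none), stk [] [] a o⟩
      ⟨none, ((I.fl, .reset), none),
        stk [] [] [] ((O.first s.1).toList ++ (a.reverse.filterMap O.bit ++ o))⟩
      (a.length + 1) := by
  induction a generalizing o with
  | nil =>
    apply StepsIn.single
    rw [TM2.step, h]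
    change some (bif (O.first s.1).isSome then
      (⟨none, ((I.fl, Scratch.reset), none), Function.update
        (Function.update (stk [] [] [] o) .spare [])
        .output ((O.first s.1).getD false :: o)⟩ : TM2.Cfg (Sym (Cell S A)) L _) else
      ⟨none, ((I.fl, Scratch.reset), none), Function.update (stk [] [] [] o) .spare []⟩) = _
    cases O.first s.1 <;>
      exact congrArg some (cfg_ext rfl rfl (by intro k; cases k <;> rfl))
  | cons c a ih =>
    refine StepsIn.head (b := ⟨some self, (s, none), stk [] [] a ((O.bit c).toList ++ o)⟩) ?_ ?_
    · rw [TM2.step, h]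
      change some (bif (O.bit c).isSome then
        (⟨some self, (s, none), Function.update (Function.update (stk [] [] (c :: a) o) .spare a)
          .output ((O.bit c).getD false :: o)⟩ : TM2.Cfg (Sym (Cell S A)) L _) else
        ⟨some self, (s, none), Function.update (stk [] [] (c :: a) o) .spare a⟩) = _
      cases O.bit c <;>
        exact congrArg some (cfg_ext rfl rfl (by intro k; cases k <;> rfl))
    · have := ih ((O.bit c).toList ++ o)
      cases hc : O.bit c <;> simpa [hc, List.filterMap_append] using this

theorem stepsIn_program {p : Cmd (Ctl F) (Cell S A)} {n : ℕ} {m : Fin n → Fin n → Bool}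
    {l : List Bool} {h' : MState F S A n} {t : ℕ}
    (hp : ∀ b, Exec p ((I.fl, .flag b), (I.state m l).cells) ((h'.fl, .reset), h'.cells) t) :
    StepsIn (program I O p)
      ⟨some (.inr .read), ((I.fl, .reset), none), stk (matrixWord m l) [] [] []⟩
      ⟨none, ((I.fl, .reset), none), stk [] [] [] (O.word h')⟩
      (t + 4 * (I.state m l).cells.length + 4) := by
  obtain ⟨b, hb⟩ := sweepList_mark I m l
  have hl := congrArg (fun x => x.2.length) hb
  simp only [length_sweepList, List.length_reverse, List.length_map] at hl
  have hl' : h'.cells.length = (I.state m l).cells.length := (hp b).length_eq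
  have h₁ := stepsIn_read (M := program I O p) (self := .inr .read) (exit := .inr .mark) rfl
    (I.fl, .reset) (matrixWord m l) []
  have h₂ := stepsIn_backward (M := program I O p) (self := .inr .mark) (exit := .inl p.entry) rfl
    [] [] (I.fl, .reset) [] ((matrixWord m l).map I.cell).reverse
  have h₃ := stepsIn_of_exec (M := program I O p) (hp b) Sum.inl (.inr .unload) (fun _ => rfl) [] []
  have h₄ := stepsIn_forward (M := program I O p) (self := .inr .unload) (exit := .inr .emit) rfl
    [] [] (h'.fl, .reset) h'.cells []
  have h₅ := stepsIn_emit (M := program I O p) (self := .inr .emit) rfl (h'.fl, .reset)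
    h'.cells.reverse []
  rw [hb] at h₂
  rw [sweepList_mk] at h₄
  simp only [List.append_nil, List.reverse_reverse, List.length_reverse, List.length_map] at *
  have := (((h₁.trans h₂).trans h₃).trans h₄).trans h₅
  rw [hl, hl'] at this
  -- The four phases around the program, namely reading, marking, unloading and writing, each pass
  -- once over the cells.
  have e (N : ℕ) : t + 4 * N + 4 = N + 1 + (N + 1) + t + (N + 1) + (N + 1) := by ring
  rw [e]
  exact this

end Correctness

/-- The machine of a program. -/
def machine [Fintype F] [Fintype S] [Fintype A] (I : Input F S A) (O : Output F S A)
    (p : Cmd (Ctl F) (Cell S A)) : FinTM2 where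
  K := Stk
  k₀ := .input
  k₁ := .output
  Γ := Sym (Cell S A)
  Λ := p.Label ⊕ Phase
  main := .inr .read
  ΛFin := have := p.fintypeLabel; inferInstance
  σ := Ctl F × Option (Cell S A)
  initialState := ((I.fl, .reset), none)
  σFin := inferInstance
  Γk₀Fin := inferInstanceAs (Fintype Γ')
  m := program I O p

/-- Functions computed by polynomial-time operations on matrices are computable in polynomial
time. -/
theorem Feasible.computable [Fintype F] [Fintype S] [Fintype A] {φ : Op F S A} (hφ : Feasible φ)
    (I : Input F S A) (O : Output F S A) {α β : Type} {ea : α → List Γ'} {eb : β → List Bool}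
    {f : α → β}
    (H : ∀ a, ∃ (n : ℕ) (m : Fin n → Fin n → Bool) (l : List Bool),
      ea a = matrixWord m l ∧ eb (f a) = O.word (φ n (I.state m l))) :
    Nonempty (TM2ComputableInPolyTime ea eb f) := by
  obtain ⟨p, P, hp⟩ := hφ
  let q : Cmd (Ctl F) (Cell S A) := .seq (.load fun s => (s.1, .reset)) p
  have key : ∀ a, ∃ t ≤ (P + 4 * Polynomial.X + 5).eval (ea a).length,
      StepsIn (program I O q) ⟨some (.inr .read), ((I.fl, .reset), none), stk (ea a) [] [] []⟩
        ⟨none, ((I.fl, .reset), none), stk [] [] [] (eb (f a))⟩ t := by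
    intro a
    obtain ⟨n, m, l, h₁, h₂⟩ := H a
    obtain ⟨t, ht, h₃⟩ := hp n (I.state m l)
    refine ⟨1 + t + 4 * (I.state m l).cells.length + 4, ?_, ?_⟩
    rotate_left
    · rw [h₁, h₂]
      exact stepsIn_program (t := 1 + t) fun b => (Exec.load _ _ _).seq h₃
    · obtain ⟨b, hb⟩ := sweepList_mark I m l
      have hl := congrArg (fun x => x.2.length) hb
      simp only [length_sweepList, List.length_reverse, List.length_map] at hl
      rw [h₁, hl]
      simp only [Polynomial.eval_add, Polynomial.eval_mul, Polynomial.eval_X,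
        Polynomial.eval_ofNat]
      omega
  refine ⟨{ tm := machine I O q, inputAlphabet := Equiv.refl _, outputAlphabet := Equiv.refl _,
            time := P + 4 * Polynomial.X + 5,
            outputsFun := fun a => ⟨⟨(key a).choose, ?_⟩, (key a).choose_spec.1⟩ }⟩
  have h₁ : initList (machine I O q) (List.map (Equiv.refl Γ').invFun (ea a)) =
      ⟨some (.inr .read), ((I.fl, .reset), none), stk (ea a) [] [] []⟩ :=
    cfg_ext rfl rfl fun k => by
      cases k
      · exact List.map_id _
      all_goals rfl
  have h₂ : haltList (machine I O q) (List.map (Equiv.refl Bool).invFun (eb (f a))) =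
      ⟨none, ((I.fl, .reset), none), stk [] [] [] (eb (f a))⟩ :=
    cfg_ext rfl rfl fun k => by
      cases k
      case output => exact List.map_id _
      all_goals rfl
  exact (congrArg ((flip bind (machine I O q).step)^[(key a).choose]) (congrArg some h₁)).trans
    (Eq.trans (key a).choose_spec.2 (congrArg some h₂.symm))

end SweepMachine

namespace VertexDeletion

/-! ### Split graphs and cluster graphs -/

section Classes

variable {V : Type} {G : SimpleGraph V}

/-- If no induced path on three vertices exists, being adjacent or equal is transitive, so it
coincides with reachability. -/
theorem isCluster_iff : IsCluster G ↔ ∀ a b c, G.Adj a b → G.Adj b c → a ≠ c → G.Adj a c := by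
  constructor
  · intro h a b c hab hbc hac
    refine h (G.connectedComponentMk a) (SimpleGraph.ConnectedComponent.mem_supp_iff _ _ |>.2 rfl)
      (SimpleGraph.ConnectedComponent.mem_supp_iff _ _ |>.2 ?_) hac
    exact SimpleGraph.ConnectedComponent.sound (hab.reachable.trans hbc.reachable).symm
  · intro h K a ha b hb hab
    have hr : G.Reachable a b := SimpleGraph.ConnectedComponent.exact
      ((SimpleGraph.ConnectedComponent.mem_supp_iff _ _).1 ha |>.trans
        ((SimpleGraph.ConnectedComponent.mem_supp_iff _ _).1 hb).symm)
    have key : ∀ c, Relation.ReflTransGen G.Adj a c → a = c ∨ G.Adj a c := by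
      intro c hc
      induction hc with
      | refl => exact Or.inl rfl
      | @tail b c _ hbc ih =>
        rcases ih with rfl | ih
        · exact Or.inr hbc
        · by_cases hac : a = c
          · exact Or.inl hac
          · exact Or.inr (h a b c ih hbc hac)
    exact (key b ((SimpleGraph.reachable_iff_reflTransGen a b).1 hr)).resolve_left hab

theorem isDeletionSet_isCluster_iff {S : Finset V} : IsDeletionSet IsCluster G S ↔
    ∀ a ∉ S, ∀ b ∉ S, ∀ c ∉ S, G.Adj a b → G.Adj b c → a ≠ c → G.Adj a c := by
  unfold IsDeletionSet
  rw [isCluster_iff]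
  constructor
  · intro h a ha b hb c hc hab hbc hac
    exact h ⟨a, ha⟩ ⟨b, hb⟩ ⟨c, hc⟩ hab hbc fun e => hac (congrArg Subtype.val e)
  · rintro h ⟨a, ha⟩ ⟨b, hb⟩ ⟨c, hc⟩ hab hbc hac
    exact h a ha b hb c hc hab hbc fun e => hac (Subtype.ext e)

theorem isSplit_compl_iff : IsSplit Gᶜ ↔ IsSplit G := by
  have key : ∀ G : SimpleGraph V, IsSplit G → IsSplit Gᶜ := fun G ⟨C, hC, hI⟩ =>
    ⟨Cᶜ, (G.isClique_compl).2 hI, by rwa [compl_compl, G.isIndepSet_compl]⟩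
  exact ⟨fun h => compl_compl G ▸ key _ h, key G⟩

theorem IsSplit.induce (h : IsSplit G) (s : Set V) : IsSplit (G.induce s) := by
  obtain ⟨C, hC, hI⟩ := h
  exact ⟨Subtype.val ⁻¹' C, fun a ha b hb hab => hC ha hb fun e => hab (Subtype.ext e),
    fun a ha b hb hab => hI ha hb fun e => hab (Subtype.ext e)⟩

/-- In the complement of a complete split graph the clique vertices are isolated and the independent
set is a clique. The converse starts from any split partition and moves at most one vertex. -/
theorem isCompleteSplit_iff (h : IsSplit G) : IsCompleteSplit G ↔ IsCluster Gᶜ := by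
  rw [isCluster_iff]
  constructor
  · rintro ⟨C, hC, hI, hCI⟩
    have key : ∀ a b, Gᶜ.Adj a b → a ∉ C := by
      intro a b hab ha
      rw [SimpleGraph.compl_adj] at hab
      by_cases hb : b ∈ C
      · exact hab.2 (hC ha hb hab.1)
      · exact hab.2 (hCI a ha b hb)
    intro a b c hab hbc hac
    exact (SimpleGraph.compl_adj _ _ _).2 ⟨hac, hI (key a b hab) (key c b hbc.symm) hac⟩
  · intro hG
    obtain ⟨C, hC, hI⟩ := h
    have hI' : ∀ a ∉ C, ∀ b ∉ C, a ≠ b → Gᶜ.Adj a b := fun a ha b hb hab =>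
      (SimpleGraph.compl_adj _ _ _).2 ⟨hab, hI ha hb hab⟩
    -- If `c` misses one vertex of the independent set, transitivity in the complement makes it miss
    -- all of them, so `c` can join that set. No other clique vertex `u` misses some `v` there,
    -- since `u`, `v`, `c` would force a non-edge inside the clique.
    by_cases hc : ∃ c ∈ C, ∃ i ∉ C, Gᶜ.Adj c i
    · obtain ⟨c, hc, i, hi, hci⟩ := hc
      have hcI : ∀ a ∉ C, Gᶜ.Adj c a := fun a ha => by
        by_cases hia : i = a
        · exact hia ▸ hci
        · exact hG c i a hci (hI' i hi a ha hia) (fun e => ha (e ▸ hc))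
      refine ⟨C \ {c}, hC.subset Set.sdiff_subset, ?_, ?_⟩
      · intro a ha b hb hab
        have e : ∀ a ∈ (C \ {c})ᶜ, a ∉ C ∨ a = c := fun a ha => by
          by_contra! hh
          exact ha ⟨hh.1, hh.2⟩
        rcases e a ha with ha' | rfl <;> rcases e b hb with hb' | rfl
        · exact hI ha' hb' hab
        · exact ((SimpleGraph.compl_adj _ _ _).1 (hcI a ha').symm).2
        · exact ((SimpleGraph.compl_adj _ _ _).1 (hcI b hb')).2
        · exact absurd rfl hab
      · intro u hu v hv
        have huv : u ≠ v := fun e => hv (e ▸ hu)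
        by_contra hn
        have huv' : Gᶜ.Adj u v := (SimpleGraph.compl_adj _ _ _).2 ⟨huv, hn⟩
        have hvC : v ∉ C := fun hvC => hn (hC hu.1 hvC huv)
        exact ((SimpleGraph.compl_adj _ _ _).1 (hG u v c huv' (hcI v hvC).symm hu.2)).2
          (hC hu.1 hc hu.2)
    · push Not at hc
      refine ⟨C, hC, hI, fun u hu v hv => ?_⟩
      by_contra hn
      exact hc u hu v hv ((SimpleGraph.compl_adj _ _ _).2 ⟨fun e => hv (e ▸ hu), hn⟩)

theorem induce_compl (s : Set V) : (G.induce s)ᶜ = Gᶜ.induce s := by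
  ext a b
  simp [SimpleGraph.compl_adj, Subtype.ext_iff]

theorem isDeletionSet_isCompleteSplit_iff (h : IsSplit G) {S : Finset V} :
    IsDeletionSet IsCompleteSplit G S ↔ IsDeletionSet IsCluster Gᶜ S := by
  unfold IsDeletionSet
  rw [isCompleteSplit_iff (h.induce _), induce_compl]

/-- The set `T` splits the vertices in `U`. -/
def SplitOn (G : SimpleGraph V) (U T : V → Prop) : Prop :=
  ∀ i j, U i → U j → i ≠ j → (T i → T j → G.Adj i j) ∧ (¬ T i → ¬ T j → ¬ G.Adj i j)

theorem SplitOn.congr {U T T' : V → Prop} (h : SplitOn G U T) (hT : ∀ i, U i → (T' i ↔ T i)) :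
    SplitOn G U T' := by
  intro i j hi hj hij
  rw [hT i hi, hT j hj]
  exact h i j hi hj hij

theorem SplitOn.isSplit {T : V → Prop} (h : SplitOn G (fun _ => True) T) : IsSplit G :=
  ⟨{i | T i}, fun i hi j hj hij => (h i j trivial trivial hij).1 hi hj,
    fun i hi j hj hij => (h i j trivial trivial hij).2 hi hj⟩

/-- A nonempty clique side is needed so that a dummy vertex can be added to it without effect. If it
is empty, the graph has no edges and `{x}` can take its place. -/
theorem IsSplit.exists_splitOn (h : IsSplit G) (x : V) :
    ∃ T : V → Prop, (∃ c, T c) ∧ ∀ U, SplitOn G U T := by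
  obtain ⟨C, hC, hI⟩ := h
  by_cases hc : C.Nonempty
  · exact ⟨(· ∈ C), hc, fun U i j _ _ hij => ⟨fun hi hj => hC hi hj hij, fun hi hj => hI hi hj hij⟩⟩
  · rw [Set.not_nonempty_iff_eq_empty] at hc
    subst hc
    exact ⟨(· = x), ⟨x, rfl⟩, fun U i j _ _ hij => ⟨fun hi hj => absurd (hi.trans hj.symm) hij,
      fun _ _ => hI (by simp) (by simp) hij⟩⟩

/-- A split partition of an induced subgraph extends to one more vertex after at most one vertex
leaves the clique and at most one vertex joins it. -/
theorem SplitOn.exists_extend {U C : V → Prop} (h : SplitOn G U C) (hG : IsSplit G) {x : V}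
    (hx : ¬ C x) :
    ∃ y z w, SplitOn G (fun i => U i ∨ i = x) fun i => (C i ∧ i ≠ y) ∨ i = z ∨ i = w := by
  classical
  obtain ⟨T, ⟨c, hc⟩, hT⟩ := hG.exists_splitOn x
  -- The vertex `w` brings `x` to the clique side if `T` wants it there, and is otherwise a dummy
  -- member of `T`.
  obtain ⟨w, hw, hxw⟩ : ∃ w, T w ∧ (T x → x = w) := by
    by_cases hTx : T x
    · exact ⟨x, hTx, fun _ => rfl⟩
    · exact ⟨c, hc, fun h => absurd h hTx⟩
  -- Within `U`, the vertices of `T` outside `C` form a clique by `T` and an independent set by `C`,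
  -- so there is at most one.
  obtain ⟨z, hz, hzU⟩ : ∃ z, T z ∧ ∀ i, U i → T i → ¬ C i → i = z := by
    by_cases hi : ∃ i, U i ∧ T i ∧ ¬ C i
    · obtain ⟨z, hz, hTz, hCz⟩ := hi
      refine ⟨z, hTz, fun i hi hTi hCi => ?_⟩
      by_contra hiz
      exact (h i z hi hz hiz).2 hCi hCz ((hT U i z hi hz hiz).1 hTi hTz)
    · push Not at hi
      exact ⟨c, hc, fun i h₁ h₂ h₃ => absurd (hi i h₁ h₂) h₃⟩
  -- The same argument with `C` and `T` exchanged. If no vertex has to leave, `y = z` is chosen: its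
  -- removal is undone by the insertion of `z`.
  obtain ⟨y, hy, hyU⟩ : ∃ y, (T y → y = z) ∧ ∀ i, U i → C i → ¬ T i → i = y := by
    by_cases hi : ∃ i, U i ∧ C i ∧ ¬ T i
    · obtain ⟨y, hy, hCy, hTy⟩ := hi
      refine ⟨y, fun h => absurd h hTy, fun i hi hCi hTi => ?_⟩
      by_contra hiy
      exact (hT U i y hi hy hiy).2 hTi hTy ((h i y hi hy hiy).1 hCi hCy)
    · push Not at hi
      exact ⟨z, fun _ => rfl, fun i h₁ h₂ h₃ => absurd (hi i h₁ h₂) h₃⟩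
  refine ⟨y, z, w, (hT _).congr fun i hi => ⟨?_, fun hTi => ?_⟩⟩
  · rintro (⟨hCi, hiy⟩ | rfl | rfl)
    · by_contra hTi
      rcases hi with hi | rfl
      · exact hiy (hyU i hi hCi hTi)
      · exact hx hCi
    · exact hz
    · exact hw
  · rcases hi with hi | rfl
    · by_cases hCi : C i
      · by_cases hiy : i = y
        · exact Or.inr (Or.inl (hiy.trans (hy (hiy ▸ hTi))))
        · exact Or.inl ⟨hCi, hiy⟩
      · exact Or.inr (Or.inl (hzU i hi hTi hCi))
    · exact Or.inr (Or.inr (hxw hTi))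

/-- The edges between the clique and the independent set that remain to be covered if `v` is
attached to the clique. -/
def AttachEdge (G : SimpleGraph V) (C : V → Prop) (v i j : V) : Prop :=
  C i ∧ ¬ C j ∧ G.Adj i j ∧ j ≠ v ∧ (C v ∨ G.Adj i v)

/-- The vertices that must be deleted if `v` is attached to the clique. -/
def AttachForced (G : SimpleGraph V) (C : V → Prop) (v i : V) : Prop :=
  C i ∧ ¬ C v ∧ ¬ G.Adj i v

/-- Outside `S`, every edge leaving the clique ends at `v`, and unless `v` lies in `C`, every clique
vertex is adjacent to `v`. Hence no induced path on three vertices survives. -/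
theorem isDeletionSet_of_attach {C : V → Prop} (hC : SplitOn G (fun _ => True) C) {v : V}
    {S : Finset V} (h₁ : ∀ i, AttachForced G C v i → i ∈ S)
    (h₂ : ∀ i j, AttachEdge G C v i j → i ∈ S ∨ j ∈ S) : IsDeletionSet IsCluster G S := by
  rw [isDeletionSet_isCluster_iff]
  have hv : ∀ i ∉ S, C i → C v ∨ G.Adj i v := fun i hi hCi => by
    by_contra! hh
    exact hi (h₁ i ⟨hCi, hh⟩)
  have key : ∀ i ∉ S, ∀ j ∉ S, C i → ¬ C j → G.Adj i j → j = v := fun i hi j hj hCi hCj hij => by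
    by_contra hjv
    rcases h₂ i j ⟨hCi, hCj, hij, hjv, hv i hi hCi⟩ with h | h
    · exact hi h
    · exact hj h
  intro a ha b hb c hc hab hbc hac
  by_cases hCb : C b
  · by_cases hCa : C a <;> by_cases hCc : C c
    · exact (hC a c trivial trivial hac).1 hCa hCc
    · obtain rfl := key b hb c hc hCb hCc hbc
      exact (hv a ha hCa).resolve_left hCc
    · obtain rfl := key b hb a ha hCb hCa hab.symm
      exact ((hv c hc hCc).resolve_left hCa).symm
    · exact absurd ((key b hb a ha hCb hCa hab.symm).trans (key b hb c hc hCb hCc hbc).symm) hac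
  · have hCa : C a := by
      by_contra hCa
      exact (hC a b trivial trivial hab.ne).2 hCa hCb hab
    have hCc : C c := by
      by_contra hCc
      exact (hC b c trivial trivial hbc.ne).2 hCb hCc hbc
    exact (hC a c trivial trivial hac).1 hCa hCc

/-- If an edge from `c ∈ C` to `v ∉ C` survives, this `v` works: a surviving clique vertex `i` not
adjacent to `v` gives the induced path `i`, `c`, `v`, and an uncovered edge `i`, `j` gives `j`, `i`,
`v`. If no such edge survives, any `v ∈ C` works. -/
theorem exists_attach [Nonempty V] {C : V → Prop} (hC : SplitOn G (fun _ => True) C)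
    {S : Finset V} (hS : IsDeletionSet IsCluster G S) :
    ∃ v, (∀ i, AttachForced G C v i → i ∈ S) ∧
      ∀ i j, AttachEdge G C v i j → i ∈ S ∨ j ∈ S := by
  rw [isDeletionSet_isCluster_iff] at hS
  by_cases h : ∃ c ∉ S, C c ∧ ∃ v ∉ S, ¬ C v ∧ G.Adj c v
  · obtain ⟨c, hc, hCc, v, hv, hCv, hcv⟩ := h
    refine ⟨v, ?_, ?_⟩
    · rintro i ⟨hCi, -, hiv⟩
      by_contra hi
      by_cases hic : i = c
      · exact hiv (hic ▸ hcv)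
      · exact hiv (hS i hi c hc v hv ((hC i c trivial trivial hic).1 hCi hCc) hcv
          fun e => hCv (e ▸ hCi))
    · rintro i j ⟨-, hCj, hij, hjv, hiv⟩
      by_contra! hh
      exact (hC j v trivial trivial hjv).2 hCj hCv
        (hS j hh.2 i hh.1 v hv hij.symm (hiv.resolve_left hCv) hjv)
  · push Not at h
    by_cases hne : ∃ v, C v
    · obtain ⟨v, hv⟩ := hne
      refine ⟨v, fun i hi => absurd hv hi.2.1, fun i j hij => ?_⟩
      by_contra! hh
      exact h i hh.1 hij.1 j hh.2 hij.2.1 hij.2.2.1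
    -- With an empty clique side there is nothing to force or to cover, so the choice of `v` is
    -- immaterial.
    · push Not at hne
      exact ⟨Classical.arbitrary V, fun i hi => absurd hi.1 (hne i),
        fun i j hij => absurd hij.1 (hne i)⟩

end Classes

/-! ### Minimum vertex covers of bipartite graphs by auction -/

section Auction

variable {n : ℕ} {H : Fin n → Fin n → Prop}

/-- The invariant of the auction algorithm: `M` is a matching of the bipartite graph `H`, right
vertices with a positive price are matched, and left vertices are matched to a neighbour whose
price is almost minimal. -/
structure IsAuction (H M : Fin n → Fin n → Prop) (p : Fin n → ℕ) : Prop where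
  sub : ∀ i j, M i j → H i j
  left : ∀ i j j', M i j → M i j' → j = j'
  right : ∀ i i' j, M i j → M i' j → i = i'
  matched : ∀ j, 0 < p j → ∃ i, M i j
  price : ∀ i j j', M i j → H i j' → p j ≤ p j' + 1
  le : ∀ j, p j ≤ n

theorem IsAuction.zero : IsAuction H (fun _ _ => False) fun _ => 0 where
  sub _ _ h := h.elim
  left _ _ _ h := h.elim
  right _ _ _ h := h.elim
  matched _ h := absurd h (lt_irrefl _)
  price _ _ _ h := h.elim
  le _ := Nat.zero_le _

/-- No unmatched left vertex can bid. -/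
def AuctionDone (H M : Fin n → Fin n → Prop) (p : Fin n → ℕ) : Prop :=
  ∀ i, (∀ j, ¬ M i j) → ∀ j, H i j → n ≤ p j

/-- For the new pair the price condition is the minimality of `p w`; for the other pairs it persists
because their own prices are unchanged and the remaining ones do not fall. The old owner of `w`
merely becomes unmatched. -/
theorem IsAuction.bid {M : Fin n → Fin n → Prop} {p : Fin n → ℕ} (h : IsAuction H M p)
    {a w : Fin n} (ha : ∀ j, ¬ M a j) (haw : H a w) (hmin : ∀ j, H a j → p w ≤ p j)
    (hw : p w < n) :
    IsAuction H (fun i j => if j = w then i = a else M i j) (Function.update p w (p w + 1)) where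
  sub i j := by
    split_ifs with hj
    · rintro rfl
      exact hj ▸ haw
    · exact h.sub i j
  left i j j' := by
    split_ifs with hj hj' hj'
    · exact fun _ _ => hj.trans hj'.symm
    · rintro rfl h'
      exact absurd h' (ha j')
    · rintro h' rfl
      exact absurd h' (ha j)
    · exact h.left i j j'
  right i i' j := by
    split_ifs with hj
    · rintro rfl rfl
      rfl
    · exact h.right i i' j
  matched j hj := by
    by_cases hjw : j = w
    · exact ⟨a, by simp [hjw]⟩
    · rw [Function.update_of_ne hjw] at hj
      obtain ⟨i, hi⟩ := h.matched j hj
      exact ⟨i, by simpa [hjw] using hi⟩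
  price i j j' hM hH := by
    have hle : p j' ≤ Function.update p w (p w + 1) j' := by
      by_cases hj' : j' = w
      · subst hj'
        simp
      · rw [Function.update_of_ne hj']
    split_ifs at hM with hj
    · subst hj hM
      have := hmin j' hH
      rw [Function.update_self]
      omega
    · rw [Function.update_of_ne hj]
      have := h.price i j j' hM hH
      omega
  le j := by
    by_cases hj : j = w
    · subst hj
      simpa using hw
    · rw [Function.update_of_ne hj]
      exact h.le j

/-- The vertex cover at price level `g`. -/
def levelCover (H : Fin n → Fin n → Prop) (p : Fin n → ℕ) (g : Fin n) (i : Fin n) : Prop :=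
  g.val < p i ∨ ∃ j, H i j ∧ p j ≤ g

theorem levelCover_covers (p : Fin n → ℕ) (g : Fin n) {i j : Fin n} (hij : H i j) :
    levelCover H p g i ∨ levelCover H p g j := by
  by_cases hj : p j ≤ g
  · exact Or.inl (Or.inr ⟨j, hij, hj⟩)
  · exact Or.inr (Or.inl (not_le.1 hj))

/-- Pigeonhole: `n` prices cannot take all the `n + 1` values from `0` to `n`. -/
theorem exists_gap [NeZero n] (p : Fin n → ℕ) :
    (∃ g : Fin n, ∀ j, p j ≠ g) ∨ ∀ j, p j ≠ n := by
  by_contra! hh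
  have hsub : Finset.range (n + 1) ⊆ Finset.univ.image p := by
    intro g hg
    rw [Finset.mem_range] at hg
    rw [Finset.mem_image]
    rcases Nat.lt_or_ge g n with h | h
    · obtain ⟨j, hj⟩ := hh.1 ⟨g, h⟩
      exact ⟨j, Finset.mem_univ _, hj⟩
    · obtain ⟨j, hj⟩ := hh.2
      exact ⟨j, Finset.mem_univ _, by omega⟩
  have h₁ := Finset.card_le_card hsub
  have h₂ := Finset.card_image_le (s := Finset.univ) (f := p)
  simp only [Finset.card_range, Finset.card_univ, Fintype.card_fin] at h₁ h₂
  omega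

/-- When the auction is over, some level gives a minimum vertex cover. -/
theorem IsAuction.exists_levelCover [NeZero n] {M : Fin n → Fin n → Prop} {p : Fin n → ℕ}
    (h : IsAuction H M p) (hd : AuctionDone H M p) {L : Fin n → Prop} (hL : ∀ i j, H i j → L i)
    (hL' : ∀ i j, H i j → ¬ L j) :
    ∃ g, ∀ X Y : Finset (Fin n), (∀ i ∈ X, levelCover H p g i) →
      (∀ i j, H i j → i ∈ Y ∨ j ∈ Y) → X.card ≤ Y.card := by
  -- A matched price exceeds the price of any neighbour by at most one, so it cannot cross a missing
  -- value `g`. If the value `n` is missing, all prices are at most `n - 1`, which serves as `g`.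
  obtain ⟨g, hg⟩ : ∃ g : Fin n, ∀ i j j', H i j → p j ≤ g → M i j' → p j' ≤ g := by
    rcases exists_gap p with ⟨g, hg⟩ | hg
    · refine ⟨g, fun i j j' hij hj hM => ?_⟩
      have h₁ := h.price i j' j hM hij
      have h₂ := hg j
      omega
    · have := NeZero.pos n
      refine ⟨⟨n - 1, by omega⟩, fun i j j' _ _ _ => ?_⟩
      have h₁ := h.le j'
      have h₂ := hg j'
      simp only
      omega
  refine ⟨g, fun X Y hX hY => ?_⟩
  -- A right vertex in the cover has positive price. An unmatched left vertex has only neighbours of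
  -- price `n > g`, because the auction is over.
  have hmatch : ∀ x, levelCover H p g x → (∃ i j, M i j ∧ (x = i ∨ x = j)) := by
    rintro x (hx | ⟨j, hxj, hj⟩)
    · obtain ⟨i, hi⟩ := h.matched x (by omega)
      exact ⟨i, x, hi, Or.inr rfl⟩
    · by_contra! hh
      have := hd x (fun j hj => (hh x j hj).1 rfl) j hxj
      omega
  have hside : ∀ i j, M i j → ¬ (levelCover H p g i ∧ levelCover H p g j) := by
    rintro i j hij ⟨hi, hj⟩
    have hHij := h.sub i j hij
    rcases hj with hj | ⟨j', hjj', -⟩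
    · rcases hi with hi | ⟨j', hij', hj'⟩
      · obtain ⟨i', hi'⟩ := h.matched i (by omega)
        exact hL' i' i (h.sub _ _ hi') (hL i j hHij)
      · have := hg i j' j hij' hj' hij
        omega
    · exact hL' i j hHij (hL j j' hjj')
  have hex : ∀ x : Fin n, ∃ y, x ∈ X → y ∈ Y ∧
      ∃ i j, M i j ∧ (x = i ∨ x = j) ∧ (y = i ∨ y = j) := by
    intro x
    by_cases hx : x ∈ X
    · obtain ⟨i, j, hij, hxij⟩ := hmatch x (hX x hx)
      rcases hY i j (h.sub i j hij) with hy | hy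
      · exact ⟨i, fun _ => ⟨hy, i, j, hij, hxij, Or.inl rfl⟩⟩
      · exact ⟨j, fun _ => ⟨hy, i, j, hij, hxij, Or.inr rfl⟩⟩
    · exact ⟨x, fun h => absurd h hx⟩
  choose f hf using hex
  -- Weak duality: distinct vertices of `X` lie on distinct matching edges, and `Y` contains an end
  -- of each of these disjoint edges.
  refine Finset.card_le_card_of_injOn f (fun x hx => (hf x hx).1) ?_
  intro x hx x' hx' hxx'
  obtain ⟨-, i, j, hij, hxij, hfij⟩ := hf x hx
  obtain ⟨-, i', j', hij', hxij', hfij'⟩ := hf x' hx'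
  rw [← hxx'] at hfij'
  have hHij := h.sub i j hij
  have hHij' := h.sub i' j' hij'
  obtain ⟨rfl, rfl⟩ : i = i' ∧ j = j' := by
    rcases hfij with e | e <;> rcases hfij' with e' | e'
    · obtain rfl := e.symm.trans e'
      exact ⟨rfl, h.left _ _ _ hij hij'⟩
    · obtain rfl := e.symm.trans e'
      exact absurd (hL _ _ hHij) (hL' _ _ hHij')
    · obtain rfl := e.symm.trans e'
      exact absurd (hL _ _ hHij') (hL' _ _ hHij)
    · obtain rfl := e.symm.trans e'
      exact ⟨h.right _ _ _ hij hij', rfl⟩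
  have hxX := hX x hx
  have hxX' := hX x' hx'
  rcases hxij with rfl | rfl <;> rcases hxij' with rfl | rfl
  · rfl
  · exact absurd ⟨hxX, hxX'⟩ (hside _ _ hij)
  · exact absurd ⟨hxX', hxX⟩ (hside _ _ hij)
  · rfl

end Auction

end VertexDeletion

namespace SweepMachine

variable {F S A : Type}

/-! ### Reasoning about operations -/

/-- Perform `φ`, then `ψ`. -/
def seqOp (φ ψ : Op F S A) : Op F S A := fun n h => ψ n (φ n h)

/-- Perform one operation, then another. -/
infixr:65 " ⨾ " => seqOp

theorem Feasible.seq {φ ψ : Op F S A} (hφ : Feasible φ) (hψ : Feasible ψ) : Feasible (φ ⨾ ψ) :=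
  hψ.comp hφ

/-- The operation `φ` does not change the part `ρ` of the state. -/
def Preserves {α : ℕ → Type} (ρ : ∀ n, MState F S A n → α n) (φ : Op F S A) : Prop :=
  ∀ n h, ρ n (φ n h) = ρ n h

theorem Preserves.seq {α : ℕ → Type} {ρ : ∀ n, MState F S A n → α n} {φ ψ : Op F S A}
    (hφ : Preserves ρ φ) (hψ : Preserves ρ ψ) : Preserves ρ (φ ⨾ ψ) :=
  fun n h => (hψ n _).trans (hφ n h)

/-- The loop invariant rule; `I k` holds before iteration `k`. The final clearing of `x` is kept
apart, since most properties ignore that field definitionally. -/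
theorem forOp_induction {x : BitField S} {φ : Op F S A} {n : ℕ} (I : ℕ → MState F S A n → Prop)
    {h : MState F S A n} (h₀ : I 0 h)
    (hs : ∀ (i : Fin n) h, I i h → I (i + 1) (φ n (h.setField x (single i)))) :
    ∃ h', I n h' ∧ forOp x φ n h = h'.setField x fun _ => false := by
  refine ⟨_, ?_, rfl⟩
  have key : ∀ d a (h : MState F S A n), a + d = n → I a h →
      I n (((List.finRange n).drop a).foldl
        (fun h (i : Fin n) => φ n (h.setField x (single i))) h) := by
    intro d
    induction d with
    | zero =>
      rintro a h rfl ha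
      rwa [List.drop_eq_nil_of_le (by simp)]
    | succ d ih =>
      intro a h had ha
      have han : a < n := by omega
      have hd : (List.finRange n).drop a = ⟨a, han⟩ :: (List.finRange n).drop (a + 1) := by
        rw [List.drop_eq_getElem_cons (by simpa using han)]
        simp
      rw [hd, List.foldl_cons]
      exact ih (a + 1) _ (by omega) (hs ⟨a, han⟩ h ha)
  exact key n 0 h (by omega) h₀

theorem forOp_inv {x : BitField S} {φ : Op F S A} {n : ℕ} (I : MState F S A n → Prop)
    (hx : ∀ h v, I h → I (h.setField x v))
    (hs : ∀ (i : Fin n) h, I h → I (φ n (h.setField x (single i)))) {h : MState F S A n}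
    (h₀ : I h) : I (forOp x φ n h) := by
  obtain ⟨h', hh', e⟩ := forOp_induction (fun _ => I) h₀ hs
  rw [e]
  exact hx _ _ hh'

theorem Preserves.for {α : ℕ → Type} {ρ : ∀ n, MState F S A n → α n} {x : BitField S}
    {φ : Op F S A} (hx : ∀ n h v, ρ n (h.setField x v) = ρ n h) (hφ : Preserves ρ φ) :
    Preserves ρ (forOp x φ) := fun n h =>
  forOp_inv (fun h' => ρ n h' = ρ n h) (fun h' v e => (hx n h' v).trans e)
    (fun _ h' e => ((hφ n _).trans (hx n h' _)).trans e) rfl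

/-- If one iteration of a loop establishes `P`, and no iteration destroys it, then the loop
establishes `P`. -/
theorem forOp_reach {x : BitField S} {φ : Op F S A} {n : ℕ} (I P : MState F S A n → Prop)
    (hIx : ∀ h v, I h → I (h.setField x v)) (hPx : ∀ h v, P h → P (h.setField x v))
    (hI : ∀ h, I h → I (φ n h)) (hP : ∀ h, I h → P h → P (φ n h)) (i₀ : Fin n)
    (h₀ : ∀ h, I h → P (φ n (h.setField x (single i₀)))) {h : MState F S A n} (hh : I h) :
    P (forOp x φ n h) := by
  obtain ⟨h', hh', e⟩ := forOp_induction (fun k h => I h ∧ (i₀.val < k → P h))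
    (x := x) (φ := φ) (h := h) ⟨hh, fun h => absurd h (Nat.not_lt_zero _)⟩ (by
      rintro i h ⟨h₁, h₂⟩
      refine ⟨hI _ (hIx _ _ h₁), fun hi => ?_⟩
      rcases Nat.lt_succ_iff_lt_or_eq.1 hi with hi | hi
      · exact hP _ (hIx _ _ h₁) (hPx _ _ (h₂ hi))
      · obtain rfl := Fin.ext hi
        exact h₀ h h₁)
  rw [e]
  exact hPx _ _ (hh'.2 i₀.isLt)

/-- Change the records of indices. -/
def setOp (g : F → S → S) : Op F S A := mapOp g fun _ _ _ a => a

/-- Change the records of pairs of indices. -/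
def entryOp (k : F → S → S → A → A) : Op F S A := mapOp (fun _ s => s) k

theorem feasible_setOp (g : F → S → S) : Feasible (setOp (A := A) g) := feasible_map _ _

theorem feasible_entryOp (k : F → S → S → A → A) : Feasible (entryOp k) := feasible_map _ _

/-- The operation `φ` does not change the field `x`. -/
abbrev Keeps (x : BitField S) (φ : Op F S A) : Prop :=
  Preserves (α := fun n => Fin n → Bool) (fun _ h i => x.get (h.st i)) φ

theorem Feasible.loop {x : BitField S} {φ : Op F S A} (hφ : Feasible φ) (hx : Keeps x φ) :
    Feasible (forOp x φ) :=
  hφ.for x fun n h i => congrFun (hx n h) i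

@[simp] theorem single_self {n : ℕ} (i : Fin n) : (single i i : Bool) = true := by simp [single]

@[simp] theorem single_eq_true {n : ℕ} {i j : Fin n} : (single i j : Bool) = true ↔ j = i := by
  simp [single, Fin.ext_iff]

end SweepMachine

namespace VertexDeletion

open SweepMachine

/-! ### The algorithm -/

/-- The flags of the algorithm. -/
structure Flags : Type where
  (c t u v d ok : Bool)

/-- The records of vertices: loop variables and sets of vertices. -/
structure Rec : Type where
  (x y z w a b q : Bool)
  (U C T N above below D B rest : Bool)

/-- The records of pairs of vertices. -/
structure Ent : Type where
  (E Q H M P : Bool)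

noncomputable instance : Fintype Flags :=
  Fintype.ofInjective (fun s => ((s.c, s.t, s.u), s.v, s.d, s.ok)) fun s s' h => by
    cases s; cases s'; simp_all

noncomputable instance : Fintype Rec :=
  Fintype.ofInjective (fun s => ((s.x, s.y, s.z, s.w), (s.a, s.b, s.q, s.U),
    (s.C, s.T, s.N, s.above), s.below, s.D, s.B, s.rest)) fun s s' h => by
    cases s; cases s'; simp_all

noncomputable instance : Fintype Ent :=
  Fintype.ofInjective (fun s => (s.E, s.Q, s.H, s.M, s.P)) fun s s' h => by
    cases s; cases s'; simp_all

namespace Rec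

def fx : BitField Rec := ⟨x, fun b s => { s with x := b }, fun _ _ => rfl⟩
def fy : BitField Rec := ⟨y, fun b s => { s with y := b }, fun _ _ => rfl⟩
def fz : BitField Rec := ⟨z, fun b s => { s with z := b }, fun _ _ => rfl⟩
def fw : BitField Rec := ⟨w, fun b s => { s with w := b }, fun _ _ => rfl⟩
def fa : BitField Rec := ⟨a, fun b s => { s with a := b }, fun _ _ => rfl⟩
def fb : BitField Rec := ⟨b, fun b s => { s with b := b }, fun _ _ => rfl⟩
def fq : BitField Rec := ⟨q, fun b s => { s with q := b }, fun _ _ => rfl⟩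
def fN : BitField Rec := ⟨N, fun b s => { s with N := b }, fun _ _ => rfl⟩
def fAbove : BitField Rec :=
  ⟨above, fun b s => { s with above := b }, fun _ _ => rfl⟩
def fBelow : BitField Rec :=
  ⟨below, fun b s => { s with below := b }, fun _ _ => rfl⟩

end Rec

open Rec

/-- States of the algorithm. -/
abbrev State (n : ℕ) : Type := MState Flags Rec Ent n

/-- Operations of the algorithm. -/
abbrev AOp : Type := Op Flags Rec Ent

/-- Set the field `s` of a vertex `i` to whether some pair `(i, j)` satisfies `p`. -/
def projOp (p : Flags → Rec → Rec → Ent → Bool) (s : BitField Rec) : AOp :=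
  forOp fq (queryOp (fun f r c e => r.q && p f r c e) (fun f b => { f with t := b }) ⨾
    setOp fun f r => s.set (bif r.q then f.t else s.get r) r)

/-- Compute the diagonal. -/
def diagOp : AOp := forOp fx (entryOp fun _ r c e => { e with Q := e.Q || (r.x && c.x) })

/-- Pass to the complement if `co` holds. -/
def complOp (co : Bool) : AOp := entryOp fun _ _ _ e => { e with E := (e.E ^^ co) && !e.Q }

/-- Adopt a variation of the partition `C` if it splits the vertices in `U`. -/
def trySplitOp : AOp :=
  (setOp fun _ s => { s with T := (s.C && !s.y) || (s.z || s.w) }) ⨾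
  queryOp (fun _ r c e => !e.Q && (r.U && c.U) && (r.T && c.T && !e.E || !r.T && !c.T && e.E))
    (fun f b => { f with t := b }) ⨾
  setOp fun f s => { s with C := bif f.t then s.C else s.T }

/-- Extend the partition to the vertex `x`. -/
def extendOp : AOp :=
  (setOp fun _ s => { s with U := s.U || s.x, C := s.C && !s.x }) ⨾
  forOp fy (forOp fz (forOp fw trySplitOp))

/-- Compute a split partition, if there is one. -/
def splitOp : AOp :=
  forOp fx extendOp ⨾
  queryOp (fun _ r c e => !e.Q && (r.C && c.C && !e.E || !r.C && !c.C && e.E))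
    (fun f b => { f with ok := !b })

/-- Set up the bipartite graph for the vertex `x`. -/
def attachOp : AOp :=
  projOp (fun _ _ c e => c.x && e.E) fN ⨾
  queryOp (fun _ r _ _ => r.x && r.C) (fun f b => { f with c := b }) ⨾
  entryOp fun f r c e =>
    { e with H := r.C && !c.C && e.E && !c.x && (f.c || r.N), M := false, P := false }

/-- Whether the left vertex `a` bids for the right vertex `w` at price `b`. -/
def Flags.bid (f : Flags) : Bool := !f.t && f.u && !f.v

/-- The left vertex `a` bids for the right vertex `w` at price `b`, if possible. -/
def bidOp : AOp :=
  queryOp (fun _ r _ e => r.a && e.M) (fun f b => { f with t := b }) ⨾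
  queryOp (fun _ r c e => r.a && c.w && e.H) (fun f b => { f with u := b }) ⨾
  queryOp (fun _ r c e => r.w && c.b && e.P) (fun f b => { f with v := b }) ⨾
  entryOp fun f r c e =>
    { e with M := bif f.bid && c.w then r.a else e.M, P := e.P || (f.bid && r.w && c.b) }

/-- All left vertices bid. -/
def scanOp : AOp := forOp fa (forOp fb (forOp fw bidOp))

/-- The auction. -/
def auctionOp : AOp := forOp fy (forOp fz scanOp)

/-- Compute the solution for the vertex `x` at the price level `y`. -/
def candidateOp : AOp :=
  projOp (fun _ _ c e => c.y && e.P) fAbove ⨾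
  projOp (fun _ _ c e => e.H && !c.above) fBelow ⨾
  setOp fun f s => { s with D := s.above || (s.below || (s.C && (!f.c && !s.N))) }

/-- Remove a vertex from `rest` if the flag `d` is set. -/
def removeOp : AOp :=
  forOp fw
    (queryOp (fun f r _ _ => f.d && (r.w && r.rest))
      (fun f b => { f with u := b, d := f.d && !b }) ⨾
      setOp fun f s => { s with rest := s.rest && !(f.u && s.w) })

/-- Replace `B` by `D` if `D` has fewer elements. -/
def compareOp : AOp :=
  (setOp fun _ s => { s with rest := s.B }) ⨾
  forOp fz (queryOp (fun _ r _ _ => r.z && r.D) (fun f b => { f with d := b }) ⨾ removeOp) ⨾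
  queryOp (fun _ r _ _ => r.rest) (fun f b => { f with t := b }) ⨾
  setOp fun f s => { s with B := bif f.t then s.D else s.B }

/-- Compute a minimum solution `B`. -/
def minimizeOp : AOp :=
  (setOp fun _ s => { s with B := true }) ⨾
  forOp fx (attachOp ⨾ auctionOp ⨾ forOp fy (candidateOp ⨾ compareOp))

/-- Subtract the number of elements of `B` from the number. -/
def countOp : AOp :=
  forOp fy (queryOp (fun _ r _ _ => r.y && r.B) (fun f b => { f with d := b }) ⨾
    decOp (fun f => f.d) (fun f b => { f with ok := f.ok && !b }))

/-- The optimization algorithm. -/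
def solveOp (co : Bool) : AOp := diagOp ⨾ complOp co ⨾ splitOp ⨾ minimizeOp

/-- The decision algorithm. -/
def decideOp (co : Bool) : AOp := solveOp co ⨾ countOp

/-! ### Feasibility -/

theorem preserves_projOp {α : ℕ → Type} {ρ : ∀ n, State n → α n}
    {p : Flags → Rec → Rec → Ent → Bool} {s : BitField Rec}
    (hq : ∀ n h v, ρ n (h.setField fq v) = ρ n h)
    (ht : ∀ n (h : State n) b, ρ n { h with fl := { h.fl with t := b } } = ρ n h)
    (hs : ∀ n h v, ρ n (h.setField s v) = ρ n h) : Preserves ρ (projOp p s) :=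
  .for hq (.seq (fun _ _ => ht _ _ _) fun _ _ => hs _ _ _)

/-- A frame rule. The hypothesis `H` lets the fields that may be overwritten take arbitrary values,
and the default argument proves it by `rfl` whenever `ρ` does not read them. The frame rules for the
larger operations are built in the same way. -/
theorem preserves_trySplitOp {α : ℕ → Type} {ρ : ∀ n, State n → α n}
    (H : ∀ n (h : State n) (T C : Fin n → Bool) t,
      ρ n { h with
        fl := { h.fl with t := t }
        st := fun i => { h.st i with T := T i, C := C i } } = ρ n h := by intros; rfl) :
    Preserves ρ trySplitOp :=
  .seq (fun n h => H n h _ (fun i => (h.st i).C) h.fl.t)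
    (.seq (fun n h => H n h (fun i => (h.st i).T) (fun i => (h.st i).C) _)
      fun n h => H n h (fun i => (h.st i).T) _ h.fl.t)

theorem preserves_extendOp {α : ℕ → Type} {ρ : ∀ n, State n → α n}
    (H : ∀ n (h : State n) (U T C y z w : Fin n → Bool) t,
      ρ n { h with
        fl := { h.fl with t := t }
        st := fun i => { h.st i with
          U := U i, T := T i, C := C i, y := y i, z := z i, w := w i } } = ρ n h := by
        intros; rfl) :
    Preserves ρ extendOp :=
  .seq (fun n h => H n h _ (fun i => (h.st i).T) _ (fun i => (h.st i).y) (fun i => (h.st i).z)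
      (fun i => (h.st i).w) h.fl.t)
    (.for (fun n h y => H n h (fun i => (h.st i).U) (fun i => (h.st i).T) (fun i => (h.st i).C) y
        (fun i => (h.st i).z) (fun i => (h.st i).w) h.fl.t)
      (.for (fun n h z => H n h (fun i => (h.st i).U) (fun i => (h.st i).T) (fun i => (h.st i).C)
          (fun i => (h.st i).y) z (fun i => (h.st i).w) h.fl.t)
        (.for (fun n h w => H n h (fun i => (h.st i).U) (fun i => (h.st i).T) (fun i => (h.st i).C)
            (fun i => (h.st i).y) (fun i => (h.st i).z) w h.fl.t)
          (preserves_trySplitOp fun n h T C t => H n h (fun i => (h.st i).U) T C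
            (fun i => (h.st i).y) (fun i => (h.st i).z) (fun i => (h.st i).w) t))))

theorem preserves_attachOp {α : ℕ → Type} {ρ : ∀ n, State n → α n}
    (H : ∀ n (h : State n) (q N : Fin n → Bool) (c t : Bool) (e m p : Fin n → Fin n → Bool),
      ρ n { h with
        fl := { h.fl with c := c, t := t }
        st := fun i => { h.st i with q := q i, N := N i }
        ar := fun i j => { h.ar i j with H := e i j, M := m i j, P := p i j } } = ρ n h := by
        intros; rfl) :
    Preserves ρ attachOp := by
  have H' : ∀ n (h : State n) (q N : Fin n → Bool) (c t : Bool),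
      ρ n { h with
        fl := { h.fl with c := c, t := t }
        st := fun i => { h.st i with q := q i, N := N i } } = ρ n h := fun n h q N c t =>
    H n h q N c t (fun i j => (h.ar i j).H) (fun i j => (h.ar i j).M) (fun i j => (h.ar i j).P)
  exact .seq (preserves_projOp (fun n h q => H' n h q (fun i => (h.st i).N) h.fl.c h.fl.t)
      (fun n h t => H' n h (fun i => (h.st i).q) (fun i => (h.st i).N) h.fl.c t)
      (fun n h N => H' n h (fun i => (h.st i).q) N h.fl.c h.fl.t))
    (.seq (fun n h => H' n h (fun i => (h.st i).q) (fun i => (h.st i).N) _ h.fl.t)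
      fun n h => H n h (fun i => (h.st i).q) (fun i => (h.st i).N) h.fl.c h.fl.t _ _ _)

theorem preserves_bidOp {α : ℕ → Type} {ρ : ∀ n, State n → α n}
    (H : ∀ n (h : State n) (t u v : Bool) (m p : Fin n → Fin n → Bool),
      ρ n { h with
        fl := { h.fl with t := t, u := u, v := v }
        ar := fun i j => { h.ar i j with M := m i j, P := p i j } } = ρ n h := by
        intros; rfl) :
    Preserves ρ bidOp :=
  .seq (fun n h => H n h _ h.fl.u h.fl.v (fun i j => (h.ar i j).M) (fun i j => (h.ar i j).P))
    (.seq (fun n h => H n h h.fl.t _ h.fl.v (fun i j => (h.ar i j).M) (fun i j => (h.ar i j).P))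
      (.seq
        (fun n h => H n h h.fl.t h.fl.u _ (fun i j => (h.ar i j).M) (fun i j => (h.ar i j).P))
        fun n h => H n h h.fl.t h.fl.u h.fl.v _ _))

theorem preserves_auctionOp {α : ℕ → Type} {ρ : ∀ n, State n → α n}
    (H : ∀ n (h : State n) (y z a b w : Fin n → Bool) (t u v : Bool)
        (m p : Fin n → Fin n → Bool),
      ρ n { h with
        fl := { h.fl with t := t, u := u, v := v }
        st := fun i => { h.st i with y := y i, z := z i, a := a i, b := b i, w := w i }
        ar := fun i j => { h.ar i j with M := m i j, P := p i j } } = ρ n h := by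
        intros; rfl) :
    Preserves ρ auctionOp := by
  have H' : ∀ n (h : State n) (y z a b w : Fin n → Bool),
      ρ n { h with
        st := fun i => { h.st i with y := y i, z := z i, a := a i, b := b i, w := w i } } =
        ρ n h := fun n h y z a b w =>
    H n h y z a b w h.fl.t h.fl.u h.fl.v (fun i j => (h.ar i j).M) (fun i j => (h.ar i j).P)
  exact .for (fun n h v => H' n h v (fun i => (h.st i).z) (fun i => (h.st i).a)
      (fun i => (h.st i).b) (fun i => (h.st i).w))
    (.for (fun n h v => H' n h (fun i => (h.st i).y) v (fun i => (h.st i).a)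
        (fun i => (h.st i).b) (fun i => (h.st i).w))
      (.for (fun n h v => H' n h (fun i => (h.st i).y) (fun i => (h.st i).z) v
          (fun i => (h.st i).b) (fun i => (h.st i).w))
        (.for (fun n h v => H' n h (fun i => (h.st i).y) (fun i => (h.st i).z)
            (fun i => (h.st i).a) v (fun i => (h.st i).w))
          (.for (fun n h v => H' n h (fun i => (h.st i).y) (fun i => (h.st i).z)
              (fun i => (h.st i).a) (fun i => (h.st i).b) v)
            (preserves_bidOp fun n h => H n h (fun i => (h.st i).y) (fun i => (h.st i).z)
              (fun i => (h.st i).a) (fun i => (h.st i).b) (fun i => (h.st i).w))))))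

theorem preserves_candidateOp {α : ℕ → Type} {ρ : ∀ n, State n → α n}
    (H : ∀ n (h : State n) (q above below D : Fin n → Bool) (t : Bool),
      ρ n { h with
        fl := { h.fl with t := t }
        st := fun i => { h.st i with
          q := q i, above := above i, below := below i, D := D i } } = ρ n h := by
        intros; rfl) :
    Preserves ρ candidateOp :=
  .seq (preserves_projOp
      (fun n h q => H n h q (fun i => (h.st i).above) (fun i => (h.st i).below)
        (fun i => (h.st i).D) h.fl.t)
      (fun n h t => H n h (fun i => (h.st i).q) (fun i => (h.st i).above)
        (fun i => (h.st i).below) (fun i => (h.st i).D) t)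
      (fun n h v => H n h (fun i => (h.st i).q) v (fun i => (h.st i).below)
        (fun i => (h.st i).D) h.fl.t))
    (.seq (preserves_projOp
        (fun n h q => H n h q (fun i => (h.st i).above) (fun i => (h.st i).below)
          (fun i => (h.st i).D) h.fl.t)
        (fun n h t => H n h (fun i => (h.st i).q) (fun i => (h.st i).above)
          (fun i => (h.st i).below) (fun i => (h.st i).D) t)
        (fun n h v => H n h (fun i => (h.st i).q) (fun i => (h.st i).above) v
          (fun i => (h.st i).D) h.fl.t))
      fun n h => H n h (fun i => (h.st i).q) (fun i => (h.st i).above)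
        (fun i => (h.st i).below) _ h.fl.t)

theorem preserves_removeOp {α : ℕ → Type} {ρ : ∀ n, State n → α n}
    (H : ∀ n (h : State n) (w rest : Fin n → Bool) (u d : Bool),
      ρ n { h with
        fl := { h.fl with u := u, d := d }
        st := fun i => { h.st i with w := w i, rest := rest i } } = ρ n h := by
        intros; rfl) :
    Preserves ρ removeOp :=
  .for (fun n h w => H n h w (fun i => (h.st i).rest) h.fl.u h.fl.d)
    (.seq (fun n h => H n h (fun i => (h.st i).w) (fun i => (h.st i).rest) _ _)
      fun n h => H n h (fun i => (h.st i).w) _ h.fl.u h.fl.d)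

theorem preserves_compareOp {α : ℕ → Type} {ρ : ∀ n, State n → α n}
    (H : ∀ n (h : State n) (z w rest B : Fin n → Bool) (t u d : Bool),
      ρ n { h with
        fl := { h.fl with t := t, u := u, d := d }
        st := fun i => { h.st i with z := z i, w := w i, rest := rest i, B := B i } } =
        ρ n h := by intros; rfl) :
    Preserves ρ compareOp :=
  .seq (fun n h => H n h (fun i => (h.st i).z) (fun i => (h.st i).w) _ (fun i => (h.st i).B)
      h.fl.t h.fl.u h.fl.d)
    (.seq (.for (fun n h v => H n h v (fun i => (h.st i).w) (fun i => (h.st i).rest)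
          (fun i => (h.st i).B) h.fl.t h.fl.u h.fl.d)
        (.seq (fun n h => H n h (fun i => (h.st i).z) (fun i => (h.st i).w)
            (fun i => (h.st i).rest) (fun i => (h.st i).B) h.fl.t h.fl.u _)
          (preserves_removeOp fun n h w rest u d => H n h (fun i => (h.st i).z) w rest
            (fun i => (h.st i).B) h.fl.t u d)))
      (.seq (fun n h => H n h (fun i => (h.st i).z) (fun i => (h.st i).w)
            (fun i => (h.st i).rest) (fun i => (h.st i).B) _ h.fl.u h.fl.d)
        fun n h => H n h (fun i => (h.st i).z) (fun i => (h.st i).w)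
            (fun i => (h.st i).rest) _ h.fl.t h.fl.u h.fl.d))

theorem feasible_projOp (p : Flags → Rec → Rec → Ent → Bool) (s : BitField Rec)
    (hs : ∀ b r, (s.set b r).q = r.q) : Feasible (projOp p s) :=
  .loop (.seq (feasible_query _ _) (feasible_setOp _))
    (.seq (fun _ _ => rfl) fun _ _ => funext fun _ => hs _ _)

theorem feasible_diagOp : Feasible diagOp := .loop (feasible_entryOp _) fun _ _ => rfl

theorem feasible_splitOp : Feasible splitOp :=
  .seq (.loop (.seq (feasible_setOp _) (.loop (.loop (.loop (.seq (feasible_setOp _)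
    (.seq (feasible_query _ _) (feasible_setOp _))) preserves_trySplitOp)
    (.for (fun _ _ _ => rfl) preserves_trySplitOp))
    (.for (fun _ _ _ => rfl) (.for (fun _ _ _ => rfl) preserves_trySplitOp))))
    preserves_extendOp) (feasible_query _ _)

theorem feasible_attachOp : Feasible attachOp :=
  .seq (feasible_projOp _ _ fun _ _ => rfl) (.seq (feasible_query _ _) (feasible_entryOp _))

theorem feasible_auctionOp : Feasible auctionOp := by
  have h₁ : Feasible bidOp := .seq (feasible_query _ _)
    (.seq (feasible_query _ _) (.seq (feasible_query _ _) (feasible_entryOp _)))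
  have h₂ := h₁.loop (x := fw) preserves_bidOp
  have h₃ := h₂.loop (x := fb) (.for (fun _ _ _ => rfl) preserves_bidOp)
  have h₄ := h₃.loop (x := fa) (.for (fun _ _ _ => rfl) (.for (fun _ _ _ => rfl) preserves_bidOp))
  have h₅ := h₄.loop (x := fz) (.for (fun _ _ _ => rfl) (.for (fun _ _ _ => rfl)
    (.for (fun _ _ _ => rfl) preserves_bidOp)))
  exact h₅.loop (.for (fun _ _ _ => rfl) (.for (fun _ _ _ => rfl) (.for (fun _ _ _ => rfl)
    (.for (fun _ _ _ => rfl) preserves_bidOp))))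

theorem feasible_candidateOp : Feasible candidateOp :=
  .seq (feasible_projOp _ _ fun _ _ => rfl)
    (.seq (feasible_projOp _ _ fun _ _ => rfl) (feasible_setOp _))

theorem feasible_compareOp : Feasible compareOp := by
  have h : Feasible removeOp := .loop (.seq (feasible_query _ _) (feasible_setOp _))
    (.seq (fun _ _ => rfl) fun _ _ => rfl)
  exact .seq (feasible_setOp _) (.seq (.loop (.seq (feasible_query _ _) h)
    (.seq (fun _ _ => rfl) preserves_removeOp)) (.seq (feasible_query _ _) (feasible_setOp _)))

theorem feasible_solveOp (co : Bool) : Feasible (solveOp co) := by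
  have h : Feasible minimizeOp :=
    .seq (feasible_setOp _) (.loop (.seq feasible_attachOp (.seq feasible_auctionOp
      (.loop (feasible_candidateOp.seq feasible_compareOp)
        (.seq preserves_candidateOp preserves_compareOp))))
      (.seq preserves_attachOp (.seq preserves_auctionOp (.for (fun _ _ _ => rfl)
        (.seq preserves_candidateOp preserves_compareOp)))))
  exact .seq feasible_diagOp (.seq (feasible_entryOp _) (.seq feasible_splitOp h))

theorem feasible_decideOp (co : Bool) : Feasible (decideOp co) :=
  .seq (feasible_solveOp co) (.loop (.seq (feasible_query _ _) (feasible_dec _ _))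
    (.seq (fun _ _ => rfl) fun _ _ => rfl))

/-! ### Correctness of the algorithm -/

section Correctness

/-! ### Projections to vertices and the diagonal -/

variable {n : ℕ}

/-- An existential over a row is known only after the row has been read, while its value is needed
in all copies of the record; hence one query for each vertex. The hypotheses say that `p` ignores
the fields written meanwhile. -/
theorem projOp_get {p : Flags → Rec → Rec → Ent → Bool} {s : BitField Rec} (h : State n)
    (hqs : ∀ b r, s.get (fq.set b r) = s.get r)
    (hq : ∀ f b r b' c e, p f (fq.set b r) (fq.set b' c) e = p f r c e)
    (ht : ∀ f t r c e, p { f with t := t } r c e = p f r c e)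
    (hs : ∀ f b r b' c e, p f (s.set b r) (s.set b' c) e = p f r c e) (i : Fin n) :
    s.get ((projOp p s n h).st i) =
      decide (∃ j, p h.fl (h.st i) (h.st j) (h.ar i j) = true) := by
  let val (h : State n) (i j : Fin n) : Bool := p h.fl (h.st i) (h.st j) (h.ar i j)
  obtain ⟨h', ⟨-, h'₂⟩, e⟩ := forOp_induction (x := fq)
    (φ := queryOp (fun f r c e => r.q && p f r c e) (fun f b => { f with t := b }) ⨾
      setOp fun f r => s.set (bif r.q then f.t else s.get r) r) (h := h)
    (fun k h' => (∀ i j, val h' i j = val h i j) ∧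
      ∀ i : Fin n, i.val < k → s.get (h'.st i) = decide (∃ j, val h i j = true))
    ⟨fun _ _ => rfl, fun i hi => absurd hi (Nat.not_lt_zero _)⟩ (by
      rintro k h' ⟨h₁, h₂⟩
      have hv : ∀ i j, val (h'.setField fq (single k)) i j = val h i j := fun i j =>
        (hq _ _ _ _ _ _).trans (h₁ i j)
      set h'' := h'.setField fq (single k) with hh''
      have hk : ∀ i, (h''.st i).q = single k i := fun i => rfl
      have hg : ∀ i, s.get (h''.st i) = s.get (h'.st i) := fun i => hqs _ _
      refine ⟨fun i j => ?_, fun i hi => ?_⟩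
      · refine ((hs _ _ _ _ _ _).trans ?_).trans (hv i j)
        exact ht _ _ _ _ _
      · have hq' : decide (∃ i j, ((h''.st i).q &&
            p h''.fl (h''.st i) (h''.st j) (h''.ar i j)) = true) =
            decide (∃ j, val h k j = true) := by
          rw [Bool.eq_iff_iff, decide_eq_true_iff, decide_eq_true_iff]
          constructor
          · rintro ⟨i, j, hij⟩
            rw [Bool.and_eq_true, hk, single_eq_true] at hij
            obtain ⟨rfl, hij⟩ := hij
            exact ⟨j, (hv i j).symm.trans hij⟩
          · rintro ⟨j, hj⟩
            refine ⟨k, j, ?_⟩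
            rw [Bool.and_eq_true, hk, single_eq_true]
            exact ⟨rfl, (hv k j).trans hj⟩
        refine (s.get_set _ _).trans ?_
        change (bif (h''.st i).q then decide (∃ i j, ((h''.st i).q &&
          p h''.fl (h''.st i) (h''.st j) (h''.ar i j)) = true) else s.get (h''.st i)) = _
        rw [hk, hq', hg]
        by_cases hik : i = k
        · subst hik
          simp
        · have : (single k i : Bool) = false := by
            rw [← Bool.not_eq_true, single_eq_true]
            exact hik
          rw [this, cond_false]
          exact h₂ i (by
            have := Fin.val_ne_of_ne hik
            omega))
  unfold projOp
  rw [e]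
  exact (hqs _ _).trans (h'₂ i i.isLt)

theorem diagOp_Q (h : State n) (hQ : ∀ i j, (h.ar i j).Q = false) (i j : Fin n) :
    ((diagOp n h).ar i j).Q = true ↔ i = j := by
  obtain ⟨h', hh', e⟩ := forOp_induction (x := fx)
    (φ := entryOp fun _ r c e => { e with Q := e.Q || (r.x && c.x) }) (h := h)
    (fun k h' => ∀ i j : Fin n, (h'.ar i j).Q = true ↔ i = j ∧ i.val < k)
    (fun i j => by simp [hQ]) (by
      intro k h' hh' i j
      change ((h'.ar i j).Q || (single k i && single k j)) = true ↔ _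
      simp only [Bool.or_eq_true, Bool.and_eq_true, single_eq_true, hh', Nat.lt_succ_iff_lt_or_eq,
        Fin.ext_iff]
      omega)
  unfold diagOp
  rw [e]
  exact (hh' i j).trans (and_iff_left i.isLt)

theorem diagOp_E (h : State n) (i j : Fin n) : ((diagOp n h).ar i j).E = (h.ar i j).E :=
  congrFun₂ ((Preserves.for (ρ := fun n (h : State n) (i j : Fin n) => (h.ar i j).E)
    (fun _ _ _ => rfl) fun _ _ => rfl : Preserves _ diagOp) n h) i j

theorem diagOp_st (h : State n) (i : Fin n) :
    ((diagOp n h).st i).U = (h.st i).U :=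
  congrFun ((Preserves.for (ρ := fun n (h : State n) (i : Fin n) => (h.st i).U)
    (fun _ _ _ => rfl) fun _ _ => rfl : Preserves _ diagOp) n h) i

theorem diagOp_num (h : State n) : (diagOp n h).num = h.num :=
  (Preserves.for (ρ := fun n (h : State n) => h.num)
    (fun _ _ _ => rfl) fun _ _ => rfl : Preserves _ diagOp) n h

/-! ### Finding a split partition -/

variable {G : SimpleGraph (Fin n)}

theorem splitOn_iff {h : State n} (hE : ∀ i j, (h.ar i j).E = true ↔ G.Adj i j)
    (hQ : ∀ i j, (h.ar i j).Q = true ↔ i = j) (U T : Fin n → Bool) :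
    SplitOn G (fun i => U i = true) (fun i => T i = true) ↔
      ¬ ∃ i j, (!(h.ar i j).Q && (U i && U j) &&
        (T i && T j && !(h.ar i j).E || !T i && !T j && (h.ar i j).E)) = true := by
  have hQ' : ∀ i j, (h.ar i j).Q = false ↔ i ≠ j := fun i j => by
    rw [← Bool.not_eq_true, hQ]
  have hE' : ∀ i j, (h.ar i j).E = false ↔ ¬ G.Adj i j := fun i j => by
    rw [← Bool.not_eq_true, hE]
  unfold SplitOn
  push Not
  refine forall₂_congr fun i j => ?_
  simp only [ne_eq, Bool.not_eq_true, Bool.and_eq_true, Bool.not_eq_eq_eq_not, Bool.not_true,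
    Bool.or_eq_true, hQ', hE, hE']
  cases T i <;> cases T j <;> simp
  all_goals tauto

theorem trySplitOp_C {h : State n} (hE : ∀ i j, (h.ar i j).E = true ↔ G.Adj i j)
    (hQ : ∀ i j, (h.ar i j).Q = true ↔ i = j) {T : Fin n → Bool}
    (hT : ∀ i, T i = (((h.st i).C && !(h.st i).y) || ((h.st i).z || (h.st i).w))) :
    (SplitOn G (fun i => (h.st i).U = true) (fun i => T i = true) ∧
      ∀ i, ((trySplitOp n h).st i).C = T i) ∨
    (¬ SplitOn G (fun i => (h.st i).U = true) (fun i => T i = true) ∧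
      ∀ i, ((trySplitOp n h).st i).C = (h.st i).C) := by
  have hC : ∀ i, ((trySplitOp n h).st i).C =
      bif decide (∃ i j, (!(h.ar i j).Q && ((h.st i).U && (h.st j).U) &&
        (T i && T j && !(h.ar i j).E || !T i && !T j && (h.ar i j).E)) = true)
      then (h.st i).C else T i := by
    intro i
    obtain rfl : T = _ := funext hT
    rfl
  have key := splitOn_iff hE hQ (fun i => (h.st i).U) T
  by_cases hs : SplitOn G (fun i => (h.st i).U = true) (fun i => T i = true)
  · refine Or.inl ⟨hs, fun i => ?_⟩
    rw [hC, decide_eq_false (key.1 hs), cond_false]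
  · refine Or.inr ⟨hs, fun i => ?_⟩
    rw [hC, decide_eq_true (not_not.1 (mt key.2 hs)), cond_true]

/-- The triple of `SplitOn.exists_extend` is met during the three nested loops. Until some variation
is adopted the partition is the original one, and a valid partition is only ever replaced by a valid
one. -/
theorem extendOp_spec {h : State n} {k : Fin n} (hE : ∀ i j, (h.ar i j).E = true ↔ G.Adj i j)
    (hQ : ∀ i j, (h.ar i j).Q = true ↔ i = j) (hx : ∀ i, (h.st i).x = single k i)
    (hU : ∀ i, (h.st i).U = true ↔ i < k) (hG : IsSplit G)
    (hC : SplitOn G (· < k) fun i => (h.st i).C = true) :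
    SplitOn G (fun i => i < k ∨ i = k) fun i => ((extendOp n h).st i).C = true := by
  let h₁ : State n := setOp (fun _ s => { s with U := s.U || s.x, C := s.C && !s.x }) n h
  have hU₁ : ∀ i, (h₁.st i).U = true ↔ i < k ∨ i = k := fun i => by
    change ((h.st i).U || (h.st i).x) = true ↔ _
    rw [Bool.or_eq_true, hU, hx, single_eq_true]
  have hC₁ : ∀ i, (h₁.st i).C = true ↔ (h.st i).C = true ∧ i ≠ k := fun i => by
    change ((h.st i).C && !(h.st i).x) = true ↔ _
    rw [Bool.and_eq_true, hx, Bool.not_eq_true', ← Bool.not_eq_true, single_eq_true]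
  have hS₁ : SplitOn G (· < k) fun i => (h₁.st i).C = true := hC.congr fun i hi => by
    rw [hC₁]
    exact and_iff_left hi.ne
  obtain ⟨y, z, w, hyzw⟩ := hS₁.exists_extend hG (x := k) (by simp [hC₁])
  let V (h : State n) : Prop := SplitOn G (fun i => i < k ∨ i = k) fun i => (h.st i).C = true
  let I (h : State n) : Prop := (∀ i j, (h.ar i j).E = true ↔ G.Adj i j) ∧
    (∀ i j, (h.ar i j).Q = true ↔ i = j) ∧ (∀ i, (h.st i).U = true ↔ i < k ∨ i = k) ∧
    (V h ∨ ∀ i, (h.st i).C = (h₁.st i).C)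
  have hVt : ∀ h', I h' → V h' → V (trySplitOp n h') := by
    rintro h' ⟨h'E, h'Q, h'U, -⟩ hV
    rcases trySplitOp_C h'E h'Q fun _ => rfl with ⟨h₁, h₂⟩ | ⟨-, h₂⟩
    · simp only [h'U] at h₁
      exact h₁.congr fun i _ => by rw [h₂ i]
    · exact hV.congr fun i _ => by rw [h₂ i]
  have hIt : ∀ h', I h' → I (trySplitOp n h') := by
    rintro h' ⟨h'E, h'Q, h'U, h'V⟩
    refine ⟨h'E, h'Q, h'U, ?_⟩
    rcases h'V with h'V | h'C
    · exact Or.inl (hVt h' ⟨h'E, h'Q, h'U, Or.inl h'V⟩ h'V)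
    · rcases trySplitOp_C h'E h'Q fun _ => rfl with ⟨h₁, h₂⟩ | ⟨-, h₂⟩
      · simp only [h'U] at h₁
        exact Or.inl (h₁.congr fun i _ => by rw [h₂ i])
      · exact Or.inr fun i => (h₂ i).trans (h'C i)
  have hIw : ∀ h', I h' → I (forOp fw trySplitOp n h') := fun h' hh' =>
    forOp_inv (x := fw) (φ := trySplitOp) I (fun _ _ h => h) (fun _ h'' hh'' => hIt _ hh'') hh'
  have hIz : ∀ h', I h' → I (forOp fz (forOp fw trySplitOp) n h') := fun h' hh' =>
    forOp_inv (x := fz) (φ := forOp fw trySplitOp) I (fun _ _ h => h)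
      (fun _ h'' hh'' => hIw _ hh'') hh'
  have hVw : ∀ h', I h' → V h' → V (forOp fw trySplitOp n h') := fun h' hh' hV =>
    (forOp_inv (x := fw) (φ := trySplitOp) (fun h => I h ∧ V h) (fun _ _ h => h)
      (fun _ h'' hh'' => ⟨hIt _ hh''.1, hVt _ hh''.1 hh''.2⟩) ⟨hh', hV⟩).2
  have hVz : ∀ h', I h' → V h' → V (forOp fz (forOp fw trySplitOp) n h') := fun h' hh' hV =>
    (forOp_inv (x := fz) (φ := forOp fw trySplitOp) (fun h => I h ∧ V h) (fun _ _ h => h)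
      (fun _ h'' hh'' => ⟨hIw _ hh''.1, hVw _ hh''.1 hh''.2⟩) ⟨hh', hV⟩).2
  have hI₁ : I h₁ := ⟨hE, hQ, hU₁, Or.inr fun _ => rfl⟩
  refine forOp_reach (x := fy) (φ := forOp fz (forOp fw trySplitOp)) I V (fun _ _ h => h)
    (fun _ _ h => h) hIz hVz y (fun h₂ hI₂ => ?_) hI₁
  refine forOp_reach (x := fz) (φ := forOp fw trySplitOp)
    (fun h => I h ∧ ∀ i, (h.st i).y = single y i) V (fun _ _ h => h)
    (fun _ _ h => h) (fun h hh => ⟨hIw h hh.1, ?_⟩) (fun h hh => hVw h hh.1) z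
    (fun h₃ hI₃ => ?_) ⟨hI₂, fun _ => rfl⟩
  · intro i
    rw [← hh.2]
    exact congrFun ((Preserves.for (ρ := fun n (h : State n) (i : Fin n) => (h.st i).y)
      (fun _ _ _ => rfl) preserves_trySplitOp) n h) i
  refine forOp_reach (x := fw) (φ := trySplitOp)
    (fun h => I h ∧ (∀ i, (h.st i).y = single y i) ∧ ∀ i, (h.st i).z = single z i) V
    (fun _ _ h => h) (fun _ _ h => h) (fun h hh => ⟨hIt h hh.1, hh.2⟩)
    (fun h hh => hVt h hh.1) w (fun h₄ hI₄ => ?_) ⟨hI₃.1, hI₃.2, fun _ => rfl⟩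
  obtain ⟨hI₄, hy₄, hz₄⟩ := hI₄
  -- At the triple `y`, `z`, `w`, either an earlier triple has succeeded or the tested variation is
  -- the one known to split.
  rcases hI₄.2.2.2 with hV₄ | hC₄
  · exact hVt (h₄.setField fw (single w)) hI₄ hV₄
  · have key : SplitOn G (fun i => i < k ∨ i = k) fun i =>
        (((h₄.st i).C && !(h₄.st i).y) || ((h₄.st i).z || single w i)) = true :=
      hyzw.congr fun i _ => by
        simp only [hC₄, hy₄, hz₄, Bool.or_eq_true, Bool.and_eq_true, single_eq_true,
          Bool.not_eq_true', ← Bool.not_eq_true]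
    rcases trySplitOp_C (h := h₄.setField fw (single w)) hI₄.1 hI₄.2.1 fun _ => rfl
      with ⟨h₁, h₂⟩ | ⟨h₁, -⟩
    · exact key.congr fun i _ => by rw [h₂ i]; rfl
    · refine absurd ?_ h₁
      have hU₄ : ∀ i, ((h₄.setField fw (single w)).st i).U = true ↔ i < k ∨ i = k := hI₄.2.2.1
      simp only [hU₄]
      exact key

theorem splitOp_spec {h : State n} (hE : ∀ i j, (h.ar i j).E = true ↔ G.Adj i j)
    (hQ : ∀ i j, (h.ar i j).Q = true ↔ i = j) (hU : ∀ i, (h.st i).U = false) :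
    ((splitOp n h).fl.ok = true ↔ IsSplit G) ∧
      (IsSplit G → SplitOn G (fun _ => True) fun i => ((splitOp n h).st i).C = true) := by
  obtain ⟨h', ⟨h'E, h'Q, -, h'C⟩, e⟩ := forOp_induction (x := fx) (φ := extendOp) (h := h)
    (fun k h => (∀ i j, (h.ar i j).E = true ↔ G.Adj i j) ∧
      (∀ i j, (h.ar i j).Q = true ↔ i = j) ∧ (∀ i : Fin n, (h.st i).U = true ↔ i.val < k) ∧
      (IsSplit G → SplitOn G (fun i => i.val < k) fun i => (h.st i).C = true))
    ⟨hE, hQ, fun i => by simp [hU], fun _ i _ hi => absurd hi (Nat.not_lt_zero _)⟩ (by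
      rintro k h₁ ⟨h₁E, h₁Q, h₁U, h₁C⟩
      have hlt : ∀ i : Fin n, i.val < k.val + 1 ↔ i < k ∨ i = k := fun i => by
        rw [Nat.lt_succ_iff_lt_or_eq, Fin.lt_def, Fin.ext_iff]
      have hp := (preserves_extendOp
        (ρ := fun n (h : State n) (i j : Fin n) => ((h.ar i j).E, (h.ar i j).Q))) n
        (h₁.setField fx (single k))
      have hpU := (Preserves.for (x := fy) (φ := forOp fz (forOp fw trySplitOp))
        (ρ := fun n (h : State n) (i : Fin n) => (h.st i).U)
        (fun _ _ _ => rfl) (.for (fun _ _ _ => rfl) (.for (fun _ _ _ => rfl)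
          preserves_trySplitOp))) n
        (setOp (fun _ s => { s with U := s.U || s.x, C := s.C && !s.x }) n
          (h₁.setField fx (single k)))
      refine ⟨fun i j => ?_, fun i j => ?_, fun i => ?_, fun hG => ?_⟩
      · rw [← h₁E]
        exact (congrArg (· = true) (Prod.ext_iff.1 (congrFun₂ hp i j)).1).to_iff
      · rw [← h₁Q]
        exact (congrArg (· = true) (Prod.ext_iff.1 (congrFun₂ hp i j)).2).to_iff
      · refine (congrArg (· = true) (congrFun hpU i)).to_iff.trans ?_
        change ((h₁.st i).U || single k i) = true ↔ _
        rw [Bool.or_eq_true, h₁U, single_eq_true, hlt]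
        rfl
      · simp only [hlt]
        exact extendOp_spec (h := h₁.setField fx (single k)) h₁E h₁Q (fun _ => rfl) h₁U hG
          (h₁C hG))
  have hC : ∀ i, ((splitOp n h).st i).C = (h'.st i).C := fun i => by
    change ((forOp fx extendOp n h).st i).C = _
    rw [e]
    rfl
  have hok : ∀ h'', forOp fx extendOp n h = h'' → (splitOp n h).fl.ok =
      !decide (∃ i j, (!(h''.ar i j).Q &&
        ((h''.st i).C && (h''.st j).C && !(h''.ar i j).E ||
          !(h''.st i).C && !(h''.st j).C && (h''.ar i j).E)) = true) := by
    rintro _ rfl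
    rfl
  replace hok : (splitOp n h).fl.ok = !decide (∃ i j, (!(h'.ar i j).Q &&
      ((h'.st i).C && (h'.st j).C && !(h'.ar i j).E ||
        !(h'.st i).C && !(h'.st j).C && (h'.ar i j).E)) = true) := (hok _ e).trans rfl
  have key := splitOn_iff h'E h'Q (fun _ => true) (fun i => (h'.st i).C)
  simp only [Bool.and_self, Bool.and_true] at key
  have hs : IsSplit G → SplitOn G (fun _ => True) fun i => (h'.st i).C = true := fun hG => by
    simpa using h'C hG
  refine ⟨?_, fun hG => ?_⟩
  · rw [hok, Bool.not_eq_true', decide_eq_false_iff_not, ← key]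
    exact ⟨fun h => SplitOn.isSplit (by simpa using h), fun hG => by simpa using hs hG⟩
  · simpa only [hC] using hs hG

theorem preserves_splitOp {α : ℕ → Type} {ρ : ∀ n, State n → α n}
    (H : ∀ n (h : State n) (x U T C y z w : Fin n → Bool) t ok,
      ρ n { h with
        fl := { h.fl with t := t, ok := ok }
        st := fun i => { h.st i with
          x := x i, U := U i, T := T i, C := C i, y := y i, z := z i, w := w i } } = ρ n h := by
        intros; rfl) :
    Preserves ρ splitOp :=
  .seq (.for (fun n h x => H n h x (fun i => (h.st i).U) (fun i => (h.st i).T)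
      (fun i => (h.st i).C) (fun i => (h.st i).y) (fun i => (h.st i).z) (fun i => (h.st i).w)
      h.fl.t h.fl.ok)
    (preserves_extendOp fun n h U T C y z w t => H n h (fun i => (h.st i).x) U T C y z w t
      h.fl.ok))
    fun n h => H n h (fun i => (h.st i).x) (fun i => (h.st i).U) (fun i => (h.st i).T)
      (fun i => (h.st i).C) (fun i => (h.st i).y) (fun i => (h.st i).z) (fun i => (h.st i).w)
      h.fl.t _

/-! ### The bipartite graph of an attached vertex and its auction -/

theorem attachOp_spec {h : State n} {v : Fin n} {C : Fin n → Prop}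
    (hE : ∀ i j, (h.ar i j).E = true ↔ G.Adj i j) (hC : ∀ i, (h.st i).C = true ↔ C i)
    (hx : ∀ i, (h.st i).x = single v i) :
    (∀ i j, ((attachOp n h).ar i j).H = true ↔ AttachEdge G C v i j) ∧
    (∀ i j, ((attachOp n h).ar i j).M = false ∧ ((attachOp n h).ar i j).P = false) ∧
    (∀ i, ((attachOp n h).st i).N = true ↔ G.Adj i v) ∧
    ((attachOp n h).fl.c = true ↔ C v) := by
  let h₁ : State n := projOp (fun _ _ c e => c.x && e.E) fN n h
  have hN : ∀ i, (h₁.st i).N = true ↔ G.Adj i v := fun i => by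
    have := projOp_get (p := fun _ _ c e => c.x && e.E) (s := fN) h (fun _ _ => rfl)
      (fun _ _ _ _ _ _ => rfl) (fun _ _ _ _ _ => rfl) (fun _ _ _ _ _ _ => rfl) i
    change (h₁.st i).N = _ at this
    rw [this, decide_eq_true_iff]
    simp only [Bool.and_eq_true, hx, single_eq_true, exists_eq_left, hE]
  have hp := preserves_projOp (p := fun _ _ c e => c.x && e.E) (s := fN)
    (ρ := fun n (h : State n) =>
      (fun i j => (h.ar i j).E, fun i => (h.st i).C, fun i => (h.st i).x))
    (fun _ _ _ => rfl) (fun _ _ _ => rfl) (fun _ _ _ => rfl) n h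
  simp only [Prod.mk.injEq] at hp
  have hE₁ : ∀ i j, (h₁.ar i j).E = true ↔ G.Adj i j := fun i j => by
    rw [← hE, ← congrFun₂ hp.1 i j]
  have hC₁ : ∀ i, (h₁.st i).C = true ↔ C i := fun i => by
    rw [← hC, ← congrFun hp.2.1 i]
  have hx₁ : ∀ i, (h₁.st i).x = single v i := fun i => by
    rw [← hx, ← congrFun hp.2.2 i]
  have hc : (attachOp n h).fl.c = true ↔ C v := by
    change decide (∃ i : Fin n, ∃ _ : Fin n, ((h₁.st i).x && (h₁.st i).C) = true) = true ↔ _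
    rw [decide_eq_true_iff]
    simp only [Bool.and_eq_true, hx₁, single_eq_true, hC₁]
    exact ⟨fun ⟨i, _, hi, hCi⟩ => hi ▸ hCi, fun h => ⟨v, v, rfl, h⟩⟩
  refine ⟨fun i j => ?_, fun i j => ⟨rfl, rfl⟩, hN, hc⟩
  have : ((attachOp n h).ar i j).H = ((h₁.st i).C && !(h₁.st j).C && (h₁.ar i j).E &&
    !(h₁.st j).x && ((attachOp n h).fl.c || (h₁.st i).N)) := rfl
  rw [this, AttachEdge]
  simp only [Bool.and_eq_true, Bool.or_eq_true, Bool.not_eq_true', ← Bool.not_eq_true, hC₁, hE₁,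
    hx₁, single_eq_true, hc, hN]
  tauto

/-- The state stores the graph `H`, the matching `M` and the prices `p`. -/
def Stores (H M : Fin n → Fin n → Prop) (p : Fin n → ℕ) (h : State n) : Prop :=
  (∀ i j, (h.ar i j).H = true ↔ H i j) ∧ (∀ i j, (h.ar i j).M = true ↔ M i j) ∧
    ∀ i j, (h.ar i j).P = true ↔ j.val < p i

/-- Prices are stored in unary, and the only test is whether `b < p w`. Since the candidate prices
`b` are tried in increasing order, `hmin` holds and a failed test means `p w = b`, a minimum. -/
theorem bidOp_spec {H M : Fin n → Fin n → Prop} {p : Fin n → ℕ} {h : State n} {a b w : Fin n}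
    (hh : Stores H M p h) (ha : ∀ i, (h.st i).a = single a i)
    (hb : ∀ i, (h.st i).b = single b i) (hw : ∀ i, (h.st i).w = single w i)
    (hmin : (∀ j, ¬ M a j) → ∀ j, H a j → b ≤ p j) :
    ((∀ j, ¬ M a j) ∧ H a w ∧ p w = b ∧ Stores H (fun i j => if j = w then i = a else M i j)
      (Function.update p w (p w + 1)) (bidOp n h)) ∨
    (¬ ((∀ j, ¬ M a j) ∧ H a w ∧ p w = b) ∧ Stores H M p (bidOp n h)) := by
  obtain ⟨hH, hM, hP⟩ := hh
  have ht : decide (∃ i j, ((h.st i).a && (h.ar i j).M) = true) = true ↔ ∃ j, M a j := by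
    rw [decide_eq_true_iff]
    simp only [Bool.and_eq_true, ha, single_eq_true, hM]
    exact ⟨fun ⟨i, j, hi, hij⟩ => ⟨j, hi ▸ hij⟩, fun ⟨j, hj⟩ => ⟨a, j, rfl, hj⟩⟩
  have hu : decide (∃ i j, ((h.st i).a && (h.st j).w && (h.ar i j).H) = true) = true ↔ H a w := by
    rw [decide_eq_true_iff]
    simp only [Bool.and_eq_true, ha, hw, single_eq_true, hH]
    exact ⟨fun ⟨i, j, ⟨hi, hj⟩, hij⟩ => hi ▸ hj ▸ hij, fun h => ⟨a, w, ⟨rfl, rfl⟩, h⟩⟩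
  have hv : decide (∃ i j, ((h.st i).w && (h.st j).b && (h.ar i j).P) = true) = true ↔
      b.val < p w := by
    rw [decide_eq_true_iff]
    simp only [Bool.and_eq_true, hb, hw, single_eq_true, hP]
    exact ⟨fun ⟨i, j, ⟨hi, hj⟩, hij⟩ => hi ▸ hj ▸ hij, fun h => ⟨w, b, ⟨rfl, rfl⟩, h⟩⟩
  set t := decide (∃ i j, ((h.st i).a && (h.ar i j).M) = true) with htd
  set u := decide (∃ i j, ((h.st i).a && (h.st j).w && (h.ar i j).H) = true) with hud
  set v := decide (∃ i j, ((h.st i).w && (h.st j).b && (h.ar i j).P) = true) with hvd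
  have hbid : (!t && u && !v) = true ↔ (∀ j, ¬ M a j) ∧ H a w ∧ p w = b := by
    simp only [Bool.and_eq_true, Bool.not_eq_true', ← Bool.not_eq_true, ht, hu, hv, not_exists]
    constructor
    · rintro ⟨⟨h₁, h₂⟩, h₃⟩
      exact ⟨h₁, h₂, le_antisymm (not_lt.1 h₃) (hmin h₁ w h₂)⟩
    · rintro ⟨h₁, h₂, h₃⟩
      exact ⟨⟨h₁, h₂⟩, h₃.not_gt⟩
  have h₁ : ∀ i j, ((bidOp n h).ar i j).H = (h.ar i j).H := fun i j => rfl
  have h₂ : ∀ i j, ((bidOp n h).ar i j).M =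
      bif (!t && u && !v) && (h.st j).w then (h.st i).a else (h.ar i j).M := fun i j => rfl
  have h₃ : ∀ i j, ((bidOp n h).ar i j).P =
      ((h.ar i j).P || ((!t && u && !v) && (h.st i).w && (h.st j).b)) := fun i j => rfl
  by_cases hc : (∀ j, ¬ M a j) ∧ H a w ∧ p w = b
  · refine Or.inl ⟨hc.1, hc.2.1, hc.2.2, fun i j => by rw [h₁, hH], fun i j => ?_, fun i j => ?_⟩
    · rw [h₂, hbid.2 hc, Bool.true_and, hw]
      beta_reduce
      by_cases hj : j = w
      · rw [if_pos hj, single_eq_true.2 hj, cond_true, ha, single_eq_true]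
      · rw [if_neg hj, Bool.eq_false_iff.2 (mt single_eq_true.1 hj), cond_false, hM]
    · rw [h₃, hbid.2 hc, Bool.true_and, hw, hb, Bool.or_eq_true, Bool.and_eq_true, single_eq_true,
        single_eq_true, hP]
      by_cases hi : i = w
      · subst hi
        rw [Function.update_self, hc.2.2, Nat.lt_succ_iff_lt_or_eq]
        simp [Fin.ext_iff]
      · simp [hi]
  · refine Or.inr ⟨hc, fun i j => by rw [h₁, hH], fun i j => ?_, fun i j => ?_⟩
    · rw [h₂, Bool.eq_false_iff.2 (mt hbid.1 hc), Bool.false_and, cond_false, hM]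
    · rw [h₃, Bool.eq_false_iff.2 (mt hbid.1 hc), Bool.false_and, Bool.false_and,
        Bool.or_false, hP]

/-- Between the start of a scan, with matching `M₀` and prices `p₀`, and now, either a bid has been
made, or nothing has changed and `s` holds. -/
def Progress (s : Prop) (H M₀ M : Fin n → Fin n → Prop) (p₀ p : Fin n → ℕ) : Prop :=
  (∑ j, p₀ j < ∑ j, p j ∧ ¬ AuctionDone H M₀ p₀) ∨ (s ∧ M = M₀ ∧ p = p₀)

/-- One step of the search for a cheapest neighbour of `a`: while `a` is unmatched, the neighbours
already passed at level `b` have price above `b`. A bid matches `a`, which makes this condition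
void, and raises the sum of the prices. -/
theorem bidOp_scan {s : Prop} {H M₀ : Fin n → Fin n → Prop} {p₀ : Fin n → ℕ} {h : State n}
    {a b w : Fin n}
    (ha : ∀ i, (h.st i).a = single a i) (hb : ∀ i, (h.st i).b = single b i)
    (hw : ∀ i, (h.st i).w = single w i)
    (hh : ∃ M p, Stores H M p h ∧ IsAuction H M p ∧ Progress s H M₀ M p₀ p ∧
      ((∀ j, ¬ M a j) → ∀ j, H a j → b ≤ p j ∧ (j < w → b < p j))) :
    ∃ M p, Stores H M p (bidOp n h) ∧ IsAuction H M p ∧ Progress s H M₀ M p₀ p ∧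
      ((∀ j, ¬ M a j) → ∀ j, H a j → b ≤ p j ∧ (j ≤ w → b < p j)) := by
  obtain ⟨M, p, hS, hA, hP, hmin⟩ := hh
  rcases bidOp_spec hS ha hb hw fun hu j hj => (hmin hu j hj).1 with ⟨hu, haw, hpw, hS'⟩ | ⟨hn, hS'⟩
  · have hlt : p w < n := hpw ▸ b.isLt
    refine ⟨_, _, hS', hA.bid hu haw (fun j hj => hpw ▸ (hmin hu j hj).1) hlt, Or.inl ⟨?_, ?_⟩,
      fun hu' => absurd (if_pos rfl |>.mpr rfl) (hu' w)⟩
    · have hsum : ∑ j, p j < ∑ j, Function.update p w (p w + 1) j := by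
        refine Finset.sum_lt_sum (fun j _ => ?_) ⟨w, Finset.mem_univ _, by simp⟩
        by_cases hj : j = w
        · subst hj; simp
        · rw [Function.update_of_ne hj]
      rcases hP with hP | ⟨-, -, rfl⟩
      · exact hP.1.trans hsum
      · exact hsum
    · rcases hP with hP | ⟨-, rfl, rfl⟩
      · exact hP.2
      · exact fun hd => absurd (hd a hu w haw) (not_le.2 hlt)
  · refine ⟨M, p, hS', hA, hP, fun hu j hj => ⟨(hmin hu j hj).1, fun hjw => ?_⟩⟩
    rcases hjw.lt_or_eq with hjw | rfl
    · exact (hmin hu j hj).2 hjw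
    · exact lt_of_le_of_ne (hmin hu j hj).1 fun e => hn ⟨hu, hj, e.symm⟩

/-- If a scan makes no bid, the state never changed, so every unmatched vertex was found to have
only neighbours of price at least `n`. -/
theorem scanOp_spec {H M₀ : Fin n → Fin n → Prop} {p₀ : Fin n → ℕ} {h : State n}
    (hS : Stores H M₀ p₀ h) (hA : IsAuction H M₀ p₀) :
    ∃ M p, Stores H M p (scanOp n h) ∧ IsAuction H M p ∧
      ((∑ j, p₀ j < ∑ j, p j ∧ ¬ AuctionDone H M₀ p₀) ∨
        (M = M₀ ∧ p = p₀ ∧ AuctionDone H M₀ p₀)) := by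
  have inner : ∀ (s : Prop) (a b : Fin n) (h : State n), (∀ i, (h.st i).a = single a i) →
      (∀ i, (h.st i).b = single b i) →
      (∃ M p, Stores H M p h ∧ IsAuction H M p ∧ Progress s H M₀ M p₀ p ∧
        ((∀ j, ¬ M a j) → ∀ j, H a j → b ≤ p j)) →
      ∃ M p, Stores H M p (forOp fw bidOp n h) ∧ IsAuction H M p ∧ Progress s H M₀ M p₀ p ∧
        ((∀ j, ¬ M a j) → ∀ j, H a j → b + 1 ≤ p j) := by
    rintro s a b h ha hb ⟨M, p, hS, hA, hP, hmin⟩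
    obtain ⟨h', ⟨-, -, M', p', hS', hA', hP', hmin'⟩, e⟩ := forOp_induction (x := fw)
      (φ := bidOp) (h := h)
      (fun k h => (∀ i, (h.st i).a = single a i) ∧ (∀ i, (h.st i).b = single b i) ∧
        ∃ M p, Stores H M p h ∧ IsAuction H M p ∧ Progress s H M₀ M p₀ p ∧
        ((∀ j, ¬ M a j) → ∀ j : Fin n, H a j → b ≤ p j ∧ (j.val < k → b < p j)))
      ⟨ha, hb, M, p, hS, hA, hP, fun hu j hj =>
        ⟨hmin hu j hj, fun h => absurd h (Nat.not_lt_zero _)⟩⟩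
      (by
        rintro w h ⟨ha, hb, hh⟩
        refine ⟨ha, hb, ?_⟩
        obtain ⟨M, p, hS, hA, hP, hmin⟩ := bidOp_scan (h := h.setField fw (single w)) ha hb
          (fun _ => rfl) hh
        exact ⟨M, p, hS, hA, hP, fun hu j hj => ⟨(hmin hu j hj).1, fun hjw =>
          (hmin hu j hj).2 (Nat.lt_succ_iff.1 hjw)⟩⟩)
    rw [e]
    exact ⟨M', p', hS', hA', hP', fun hu j hj => (hmin' hu j hj).2 j.isLt⟩
  have hkeep : ∀ h : State n, ∀ i, ((forOp fw bidOp n h).st i).a = (h.st i).a := fun h i =>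
    congrFun ((Preserves.for (ρ := fun n (h : State n) (i : Fin n) => (h.st i).a)
      (fun _ _ _ => rfl) preserves_bidOp) n h) i
  have middle : ∀ (s : Prop) (a : Fin n) (h : State n), (∀ i, (h.st i).a = single a i) →
      (∃ M p, Stores H M p h ∧ IsAuction H M p ∧ Progress s H M₀ M p₀ p) →
      ∃ M p, Stores H M p (forOp fb (forOp fw bidOp) n h) ∧ IsAuction H M p ∧
        Progress s H M₀ M p₀ p ∧ ((∀ j, ¬ M a j) → ∀ j, H a j → n ≤ p j) := by
    rintro s a h ha ⟨M, p, hS, hA, hP⟩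
    obtain ⟨h', ⟨-, hh'⟩, e⟩ := forOp_induction (x := fb)
      (φ := forOp fw bidOp) (h := h)
      (fun k h => (∀ i, (h.st i).a = single a i) ∧
        ∃ M p, Stores H M p h ∧ IsAuction H M p ∧ Progress s H M₀ M p₀ p ∧
        ((∀ j, ¬ M a j) → ∀ j : Fin n, H a j → k ≤ p j))
      ⟨ha, M, p, hS, hA, hP, fun _ _ _ => Nat.zero_le _⟩
      (by
        rintro b h ⟨ha, hh⟩
        exact ⟨fun i => (hkeep _ i).trans (ha i),
          inner s a b (h.setField fb (single b)) ha (fun _ => rfl) hh⟩)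
    rw [e]
    exact hh'
  obtain ⟨h', ⟨M, p, hS', hA', hh'⟩, e⟩ := forOp_induction (x := fa)
    (φ := forOp fb (forOp fw bidOp)) (h := h)
    (fun k h => ∃ M p, Stores H M p h ∧ IsAuction H M p ∧
      Progress (∀ i : Fin n, i.val < k → (∀ j, ¬ M₀ i j) → ∀ j, H i j → n ≤ p₀ j) H M₀ M p₀ p)
    ⟨M₀, p₀, hS, hA, Or.inr ⟨fun i hi => absurd hi (Nat.not_lt_zero _), rfl, rfl⟩⟩
    (by
      rintro a h hh
      obtain ⟨M, p, hS, hA, hP, hmin⟩ := middle _ a (h.setField fa (single a)) (fun _ => rfl) hh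
      refine ⟨M, p, hS, hA, hP.imp_right ?_⟩
      rintro ⟨hs, rfl, rfl⟩
      refine ⟨fun i hi => ?_, rfl, rfl⟩
      rcases Nat.lt_succ_iff_lt_or_eq.1 hi with hi | hi
      · exact hs i hi
      · obtain rfl := Fin.ext hi
        exact hmin)
  unfold scanOp
  rw [e]
  exact ⟨M, p, hS', hA', hh'.imp_right fun h => ⟨h.2.1, h.2.2, fun i => h.1 i i.isLt⟩⟩

theorem auctionOp_spec {H : Fin n → Fin n → Prop} {h : State n}
    (hH : ∀ i j, (h.ar i j).H = true ↔ H i j)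
    (hMP : ∀ i j, (h.ar i j).M = false ∧ (h.ar i j).P = false) :
    ∃ M p, Stores H M p (auctionOp n h) ∧ IsAuction H M p ∧ AuctionDone H M p := by
  have scan : ∀ (k : ℕ) (h : State n),
      (∃ M p, Stores H M p h ∧ IsAuction H M p ∧ (AuctionDone H M p ∨ k ≤ ∑ j, p j)) →
      ∃ M p, Stores H M p (scanOp n h) ∧ IsAuction H M p ∧
        (AuctionDone H M p ∨ k + 1 ≤ ∑ j, p j) := by
    rintro k h ⟨M, p, hS, hA, hk⟩
    obtain ⟨M', p', hS', hA', hh⟩ := scanOp_spec hS hA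
    refine ⟨M', p', hS', hA', ?_⟩
    rcases hh with ⟨h₁, h₂⟩ | ⟨rfl, rfl, hd⟩
    · exact Or.inr (Nat.succ_le_of_lt ((hk.resolve_left h₂).trans_lt h₁))
    · exact Or.inl hd
  obtain ⟨h', ⟨M, p, hS, hA, hd⟩, e⟩ := forOp_induction (x := fy) (φ := forOp fz scanOp) (h := h)
    (fun k h => ∃ M p, Stores H M p h ∧ IsAuction H M p ∧
      (AuctionDone H M p ∨ k * n ≤ ∑ j, p j))
    ⟨_, _, ⟨hH, fun i j => by simp [hMP], fun i j => by simp [hMP]⟩, IsAuction.zero,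
      Or.inr (by simp)⟩
    (by
      intro i h hh
      obtain ⟨h', hh', e⟩ := forOp_induction (x := fz) (φ := scanOp)
        (h := h.setField fy (single i))
        (fun k h => ∃ M p, Stores H M p h ∧ IsAuction H M p ∧
          (AuctionDone H M p ∨ i * n + k ≤ ∑ j, p j)) hh
        (fun j h hh => scan _ (h.setField fz (single j)) hh)
      rw [e, Nat.succ_mul]
      exact hh')
  unfold auctionOp
  rw [e]
  -- After `n * n` scans, each of which raised the sum, all prices equal `n` and nobody can bid.
  refine ⟨M, p, hS, hA, hd.elim id fun hsum i _ j _ => ?_⟩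
  by_contra! hlt
  have : ∑ j, p j < ∑ _j : Fin n, n :=
    Finset.sum_lt_sum (fun j _ => hA.le j) ⟨j, Finset.mem_univ _, hlt⟩
  simp at this
  omega

theorem candidateOp_spec {H M : Fin n → Fin n → Prop} {p : Fin n → ℕ} {C : Fin n → Prop}
    {h : State n} {v g : Fin n} (hh : Stores H M p h) (hy : ∀ i, (h.st i).y = single g i)
    (hC : ∀ i, (h.st i).C = true ↔ C i) (hN : ∀ i, (h.st i).N = true ↔ G.Adj i v)
    (hc : h.fl.c = true ↔ C v) (i : Fin n) :
    ((candidateOp n h).st i).D = true ↔ levelCover H p g i ∨ AttachForced G C v i := by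
  let h₁ : State n := projOp (fun _ _ c e => c.y && e.P) fAbove n h
  let h₂ : State n := projOp (fun _ _ c e => e.H && !c.above) fBelow n h₁
  have hp₁ := preserves_projOp (p := fun _ _ c e => c.y && e.P) (s := fAbove)
    (ρ := fun n (h : State n) =>
      (fun i => ((h.st i).C, (h.st i).N), fun i j => (h.ar i j).H, h.fl.c))
    (fun _ _ _ => rfl) (fun _ _ _ => rfl) (fun _ _ _ => rfl) n h
  have hp₂ := preserves_projOp (p := fun _ _ c e => e.H && !c.above) (s := fBelow)
    (ρ := fun n (h : State n) => (fun i => ((h.st i).C, (h.st i).N, (h.st i).above), h.fl.c))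
    (fun _ _ _ => rfl) (fun _ _ _ => rfl) (fun _ _ _ => rfl) n h₁
  simp only [Prod.mk.injEq, funext_iff] at hp₁ hp₂
  have ha : ∀ i, (h₁.st i).above = true ↔ g.val < p i := fun i => by
    have := projOp_get (p := fun _ _ c e => c.y && e.P) (s := fAbove) h (fun _ _ => rfl)
      (fun _ _ _ _ _ _ => rfl) (fun _ _ _ _ _ => rfl) (fun _ _ _ _ _ _ => rfl) i
    change (h₁.st i).above = _ at this
    rw [this, decide_eq_true_iff]
    simp only [Bool.and_eq_true, hy, single_eq_true, exists_eq_left, hh.2.2]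
  have hb : ∀ i, (h₂.st i).below = true ↔ ∃ j, H i j ∧ p j ≤ g := fun i => by
    have := projOp_get (p := fun _ _ c e => e.H && !c.above) (s := fBelow) h₁ (fun _ _ => rfl)
      (fun _ _ _ _ _ _ => rfl) (fun _ _ _ _ _ => rfl) (fun _ _ _ _ _ _ => rfl) i
    change (h₂.st i).below = _ at this
    rw [this, decide_eq_true_iff]
    simp only [Bool.and_eq_true, Bool.not_eq_true', ← Bool.not_eq_true, ha, not_lt]
    refine exists_congr fun j => and_congr_left fun _ => ?_
    rw [← hh.1, ← hp₁.2.1 i j]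
  have : ((candidateOp n h).st i).D = ((h₂.st i).above || ((h₂.st i).below ||
    ((h₂.st i).C && (!h₂.fl.c && !(h₂.st i).N)))) := rfl
  rw [this, (hp₂.1 i).1, (hp₂.1 i).2.1, (hp₂.1 i).2.2, hp₂.2, (hp₁.1 i).1, (hp₁.1 i).2, hp₁.2.2]
  simp only [Bool.or_eq_true, Bool.and_eq_true, Bool.not_eq_true', ← Bool.not_eq_true, ha, hb, hC,
    hN, hc, levelCover, AttachForced, or_assoc]

/-! ### Comparing cardinalities without counters -/

/-- The set with a given characteristic vector. -/
def marked (s : Fin n → Bool) : Finset (Fin n) := Finset.univ.filter fun i => s i = true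

@[simp] theorem mem_marked {s : Fin n → Bool} {i : Fin n} : i ∈ marked s ↔ s i = true := by
  simp [marked]

/-- The number of elements below `k` of the set with a given characteristic vector. -/
def countBelow (s : Fin n → Bool) (k : ℕ) : ℕ :=
  (Finset.univ.filter fun i : Fin n => i.val < k ∧ s i = true).card

@[simp] theorem countBelow_zero (s : Fin n → Bool) : countBelow s 0 = 0 := by
  simp [countBelow]

theorem countBelow_self (s : Fin n → Bool) : countBelow s n = (marked s).card := by
  simp [countBelow, marked]

theorem countBelow_succ (s : Fin n → Bool) (k : Fin n) :
    countBelow s (k + 1) = countBelow s k + (s k).toNat := by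
  unfold countBelow
  cases hk : s k
  · rw [Bool.toNat_false, add_zero]
    congr 1
    ext i
    simp only [Finset.mem_filter, Finset.mem_univ, true_and, and_congr_left_iff]
    intro hi
    have : i.val ≠ k.val := fun e => by simp [Fin.ext e, hk] at hi
    omega
  · rw [Bool.toNat_true, ← Finset.card_insert_of_notMem (a := k) (by simp)]
    congr 1
    ext i
    simp only [Finset.mem_filter, Finset.mem_univ, true_and, Finset.mem_insert, Fin.ext_iff]
    constructor
    · rintro ⟨h₁, h₂⟩
      by_cases e : i.val = k.val
      · exact Or.inl e
      · exact Or.inr ⟨by omega, h₂⟩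
    · rintro (e | ⟨h₁, h₂⟩)
      · exact ⟨by omega, by rw [Fin.ext e, hk]⟩
      · exact ⟨by omega, h₂⟩

/-- The flag `d` is a token that the first element of `rest` consumes. It stays unused only when
`rest` is empty, in agreement with truncated subtraction. -/
theorem removeOp_spec (h : State n) :
    (marked fun i => ((removeOp n h).st i).rest).card =
      (marked fun i => (h.st i).rest).card - h.fl.d.toNat := by
  obtain ⟨h', hh', e⟩ := forOp_induction (x := fw) (φ := queryOp
      (fun f r _ _ => f.d && (r.w && r.rest)) (fun f b => { f with u := b, d := f.d && !b }) ⨾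
      setOp fun f s => { s with rest := s.rest && !(f.u && s.w) }) (h := h)
    (fun k h' => (h'.fl.d = h.fl.d ∧ (∀ i, (h'.st i).rest = (h.st i).rest) ∧
      (h.fl.d = true → ∀ i : Fin n, i.val < k → (h.st i).rest = false)) ∨
      (h.fl.d = true ∧ h'.fl.d = false ∧ (marked fun i => (h'.st i).rest).card + 1 =
        (marked fun i => (h.st i).rest).card))
    (Or.inl ⟨rfl, fun _ => rfl, fun _ i hi => absurd hi (Nat.not_lt_zero _)⟩) (by
      rintro k h' hh'
      set h'' : State n := (queryOp (fun f r _ _ => f.d && (r.w && r.rest))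
        (fun f b => { f with u := b, d := f.d && !b }) ⨾
        setOp fun f s => { s with rest := s.rest && !(f.u && s.w) }) n
          (h'.setField fw (single k)) with hh''
      have hu : decide (∃ i _j : Fin n, (h'.fl.d && (single k i && (h'.st i).rest)) = true) =
          (h'.fl.d && (h'.st k).rest) := by
        rw [Bool.eq_iff_iff, decide_eq_true_iff]
        simp only [Bool.and_eq_true, single_eq_true]
        exact ⟨fun ⟨i, _, h₁, h₂, h₃⟩ => ⟨h₁, h₂ ▸ h₃⟩, fun ⟨h₁, h₂⟩ => ⟨k, k, h₁, rfl, h₂⟩⟩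
      have hd : h''.fl.d = (h'.fl.d && !(h'.fl.d && (h'.st k).rest)) := by
        rw [← hu]
        rfl
      have hr : ∀ i, (h''.st i).rest =
          ((h'.st i).rest && !((h'.fl.d && (h'.st k).rest) && single k i)) := fun i => by
        rw [← hu]
        rfl
      rcases hh' with ⟨h₁, h₂, h₃⟩ | ⟨h₁, h₂, h₃⟩
      · rw [h₁, h₂] at hd
        simp only [h₁, h₂] at hr
        by_cases hk : h.fl.d = true ∧ (h.st k).rest = true
        · rw [hk.1, hk.2] at hd
          refine Or.inr ⟨hk.1, hd, ?_⟩
          simp only [hk.1, hk.2, Bool.true_and] at hr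
          rw [← Finset.card_erase_add_one (a := k) (s := marked fun i => (h.st i).rest)
            (by simpa using hk.2)]
          congr 2
          ext i
          simp [hr, ← Bool.not_eq_true, and_comm]
        · have : (h.fl.d && (h.st k).rest) = false := by simpa using hk
          simp only [this, Bool.not_false, Bool.and_true, Bool.false_and] at hd hr
          refine Or.inl ⟨hd, hr, fun hd' i hi => ?_⟩
          rcases Nat.lt_succ_iff_lt_or_eq.1 hi with hi | hi
          · exact h₃ hd' i hi
          · obtain rfl := Fin.ext hi
            exact Bool.eq_false_iff.2 fun h => hk ⟨hd', h⟩
      · simp only [h₂, Bool.false_and, Bool.not_false, Bool.and_true] at hd hr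
        refine Or.inr ⟨h₁, hd, ?_⟩
        simpa only [hr] using h₃)
  have hr : ∀ i, ((removeOp n h).st i).rest = (h'.st i).rest := fun i => by
    unfold removeOp
    rw [e]
    rfl
  simp only [hr]
  rcases hh' with ⟨-, h₂, h₃⟩ | ⟨h₁, -, h₃⟩
  · simp only [h₂]
    cases hd : h.fl.d
    · simp
    · have : (marked fun i => (h.st i).rest) = ∅ := by
        ext i
        simp [h₃ hd i i.isLt]
      simp [this]
  · rw [h₁, Bool.toNat_true]
    omega

/-- One element of a copy of `B` is removed for every element of `D`; something is left exactly when
`D` is smaller. -/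
theorem compareOp_spec (h : State n) :
    (marked fun i => ((compareOp n h).st i).B) =
      if (marked fun i => (h.st i).D).card < (marked fun i => (h.st i).B).card
      then marked fun i => (h.st i).D else marked fun i => (h.st i).B := by
  obtain ⟨h', ⟨h₁, h₂⟩, e⟩ := forOp_induction (x := fz) (φ := queryOp (fun _ r _ _ => r.z && r.D)
      (fun f b => { f with d := b }) ⨾ removeOp)
    (h := setOp (fun _ s => { s with rest := s.B }) n h)
    (fun k h' => (fun i => ((h'.st i).B, (h'.st i).D)) = (fun i => ((h.st i).B, (h.st i).D)) ∧
      (marked fun i => (h'.st i).rest).card =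
        (marked fun i => (h.st i).B).card - countBelow (fun i => (h.st i).D) k)
    ⟨rfl, by rw [countBelow_zero]; rfl⟩ (by
      rintro k h' ⟨h₁, h₂⟩
      have hp := preserves_removeOp (ρ := fun n (h : State n) (i : Fin n) =>
        ((h.st i).B, (h.st i).D)) (n := n)
      refine ⟨(hp _).trans h₁, (removeOp_spec _).trans ?_⟩
      have hd : decide (∃ i _j : Fin n, (single k i && (h'.st i).D) = true) = (h.st k).D := by
        rw [Bool.eq_iff_iff, decide_eq_true_iff]
        have h₁D : ∀ i, (h'.st i).D = (h.st i).D := fun i => (Prod.ext_iff.1 (congrFun h₁ i)).2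
        simp only [Bool.and_eq_true, single_eq_true, h₁D]
        exact ⟨fun ⟨i, _, h₂, h₃⟩ => h₂ ▸ h₃, fun h₂ => ⟨k, k, rfl, h₂⟩⟩
      rw [countBelow_succ, ← Nat.sub_sub, ← h₂, ← hd]
      rfl)
  have h₁' : ∀ i, (h'.st i).B = (h.st i).B ∧ (h'.st i).D = (h.st i).D := fun i =>
    Prod.ext_iff.1 (congrFun h₁ i)
  have hB : ∀ h'', h'' = h' → ∀ i, (((queryOp (fun _ r _ _ => r.rest)
      (fun f b => { f with t := b }) ⨾ setOp fun f s => { s with B := bif f.t then s.D else s.B })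
        n (h''.setField fz fun _ => false)).st i).B =
      bif decide (∃ i _j : Fin n, (h'.st i).rest = true) then (h.st i).D else (h.st i).B := by
    rintro _ rfl i
    rw [← (h₁' i).1, ← (h₁' i).2]
    rfl
  have hB' : ∀ i, ((compareOp n h).st i).B =
      bif decide (∃ i _j : Fin n, (h'.st i).rest = true) then (h.st i).D else (h.st i).B := by
    intro i
    rw [← hB _ rfl, ← e]
    rfl
  have ht : (∃ i _j : Fin n, (h'.st i).rest = true) ↔
      (marked fun i => (h.st i).D).card < (marked fun i => (h.st i).B).card := by
    rw [← Nat.sub_pos_iff_lt, ← countBelow_self fun i => (h.st i).D, ← h₂, Finset.card_pos]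
    exact ⟨fun ⟨i, _, h⟩ => ⟨i, mem_marked.2 h⟩, fun ⟨i, h⟩ => ⟨i, i, mem_marked.1 h⟩⟩
  simp only [hB', ht]
  split_ifs with hlt <;> simp [hlt]

/-! ### Minimizing over the attached vertex and the price level -/

theorem level_spec {v : Fin n} {C : Fin n → Prop} {h : State n}
    (hE : ∀ i j, (h.ar i j).E = true ↔ G.Adj i j) (hC : ∀ i, (h.st i).C = true ↔ C i)
    (hx : ∀ i, (h.st i).x = single v i) (hS : SplitOn G (fun _ => True) C)
    (hB : IsDeletionSet IsCluster G (marked fun i => (h.st i).B)) {h' : State n}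
    (hh' : h' = (attachOp ⨾ auctionOp ⨾ forOp fy (candidateOp ⨾ compareOp)) n h) :
    IsDeletionSet IsCluster G (marked fun i => (h'.st i).B) ∧
      (marked fun i => (h'.st i).B).card ≤ (marked fun i => (h.st i).B).card ∧
      ∀ T : Finset (Fin n), (∀ i, AttachForced G C v i → i ∈ T) →
        (∀ i j, AttachEdge G C v i j → i ∈ T ∨ j ∈ T) →
        (marked fun i => (h'.st i).B).card ≤ T.card := by
  obtain ⟨hH, hMP, hN, hc⟩ := attachOp_spec hE hC hx
  obtain ⟨M, p, hSt, hA, hd⟩ := auctionOp_spec hH hMP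
  have p₁ := (preserves_attachOp (ρ := fun n (h : State n) (i : Fin n) => ((h.st i).C, (h.st i).B)))
    n h
  have p₂ := (preserves_auctionOp (ρ := fun n (h : State n) =>
    (fun (i : Fin n) => ((h.st i).C, (h.st i).B, (h.st i).N), h.fl.c))) n (attachOp n h)
  simp only [Prod.mk.injEq, funext_iff] at p₁ p₂
  obtain ⟨h₁, ⟨-, -, -, -, h₁B, h₁le, h₁min⟩, e⟩ := forOp_induction (x := fy)
    (φ := candidateOp ⨾ compareOp) (h := auctionOp n (attachOp n h))
    (fun k h₁ => Stores (AttachEdge G C v) M p h₁ ∧ (∀ i, (h₁.st i).C = true ↔ C i) ∧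
      (∀ i, (h₁.st i).N = true ↔ G.Adj i v) ∧ (h₁.fl.c = true ↔ C v) ∧
      IsDeletionSet IsCluster G (marked fun i => (h₁.st i).B) ∧
      (marked fun i => (h₁.st i).B).card ≤ (marked fun i => (h.st i).B).card ∧
      ∀ g : Fin n, g.val < k → ∀ X : Finset (Fin n),
        (∀ i, levelCover (AttachEdge G C v) p g i ∨ AttachForced G C v i → i ∈ X) →
        (marked fun i => (h₁.st i).B).card ≤ X.card)
    ⟨hSt, fun i => by rw [(p₂.1 i).1, (p₁ i).1, hC], fun i => by rw [(p₂.1 i).2.2, hN],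
      by rw [p₂.2, hc], by simpa only [(p₂.1 _).2.1, (p₁ _).2] using hB,
      by simp only [(p₂.1 _).2.1, (p₁ _).2, le_refl],
      fun g hg => absurd hg (Nat.not_lt_zero _)⟩
    (by
      rintro g h₁ ⟨h₁S, h₁C, h₁N, h₁c, h₁B, h₁le, h₁min⟩
      have hD := candidateOp_spec (h := h₁.setField fy (single g)) h₁S (fun _ => rfl) h₁C h₁N h₁c
      have p₃ := (preserves_candidateOp (ρ := fun n (h : State n) =>
        (fun (i : Fin n) => ((h.st i).C, (h.st i).B, (h.st i).N), h.fl.c,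
          fun i j => (h.ar i j).H, fun i j => (h.ar i j).M, fun i j => (h.ar i j).P))) n
          (h₁.setField fy (single g))
      set h₂ := candidateOp n (h₁.setField fy (single g)) with hh₂
      have p₄ := (preserves_compareOp (ρ := fun n (h : State n) =>
        (fun (i : Fin n) => ((h.st i).C, (h.st i).N), h.fl.c,
          fun i j => (h.ar i j).H, fun i j => (h.ar i j).M, fun i j => (h.ar i j).P))) n h₂
      have hB := compareOp_spec h₂
      change _ ∧ _ ∧ _ ∧ _ ∧ IsDeletionSet IsCluster G (marked fun i => ((compareOp n h₂).st i).B) ∧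
        (marked fun i => ((compareOp n h₂).st i).B).card ≤ _ ∧ ∀ g : Fin n, _ → ∀ X, _ →
          (marked fun i => ((compareOp n h₂).st i).B).card ≤ _
      simp only [Prod.mk.injEq, funext_iff] at p₃ p₄
      have hB₂ : (marked fun i => (h₂.st i).B) = marked fun i => (h₁.st i).B := by
        simp only [(p₃.1 _).2.1]
        rfl
      rw [hB₂] at hB
      have hDB : (marked fun i => ((compareOp n h₂).st i).B).card ≤
          (marked fun i => (h₂.st i).D).card := by
        rw [hB]; split_ifs <;> omega
      have hBB : (marked fun i => ((compareOp n h₂).st i).B).card ≤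
          (marked fun i => (h₁.st i).B).card := by
        rw [hB]; split_ifs <;> omega
      refine ⟨⟨fun i j => ?_, fun i j => ?_, fun i j => ?_⟩, fun i => ?_, fun i => ?_, ?_, ?_,
        hBB.trans h₁le, fun g' hg' X hX => ?_⟩
      · refine Iff.trans (Eq.to_iff ?_) (h₁S.1 i j)
        exact congrArg (· = true) ((p₄.2.2.1 i j).trans (p₃.2.2.1 i j))
      · refine Iff.trans (Eq.to_iff ?_) (h₁S.2.1 i j)
        exact congrArg (· = true) ((p₄.2.2.2.1 i j).trans (p₃.2.2.2.1 i j))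
      · refine Iff.trans (Eq.to_iff ?_) (h₁S.2.2 i j)
        exact congrArg (· = true) ((p₄.2.2.2.2 i j).trans (p₃.2.2.2.2 i j))
      · refine Iff.trans (Eq.to_iff ?_) (h₁C i)
        exact congrArg (· = true) ((p₄.1 i).1.trans (p₃.1 i).1)
      · refine Iff.trans (Eq.to_iff ?_) (h₁N i)
        exact congrArg (· = true) ((p₄.1 i).2.trans (p₃.1 i).2.2)
      · refine Iff.trans (Eq.to_iff ?_) h₁c
        exact congrArg (· = true) (p₄.2.1.trans p₃.2.1)
      · rw [hB]
        split_ifs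
        · exact isDeletionSet_of_attach hS (fun i hi => mem_marked.2 ((hD i).2 (Or.inr hi)))
            fun i j hij => (levelCover_covers p g hij).imp
              (fun hi => mem_marked.2 ((hD i).2 (Or.inl hi)))
              fun hj => mem_marked.2 ((hD j).2 (Or.inl hj))
        · exact h₁B
      · rcases Nat.lt_succ_iff_lt_or_eq.1 hg' with hg' | hg'
        · exact hBB.trans (h₁min g' hg' X hX)
        · obtain rfl := Fin.ext hg'
          exact hDB.trans (Finset.card_le_card fun i hi => hX i ((hD i).1 (mem_marked.1 hi))))
  have hB' : (marked fun i => (h'.st i).B) = marked fun i => (h₁.st i).B := by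
    subst hh'
    change (marked fun i => ((forOp fy (candidateOp ⨾ compareOp) n
      (auctionOp n (attachOp n h))).st i).B) = _
    rw [e]
    rfl
  rw [hB']
  refine ⟨h₁B, h₁le, fun T hT₁ hT₂ => ?_⟩
  have : NeZero n := ⟨fun hn => by subst hn; exact v.elim0⟩
  obtain ⟨g, hg⟩ := hA.exists_levelCover hd (L := C) (fun _ _ h => h.1) fun _ _ h => h.2.1
  classical
  let X : Finset (Fin n) := Finset.univ.filter fun i => levelCover (AttachEdge G C v) p g i
  let Y : Finset (Fin n) := Finset.univ.filter fun i => AttachForced G C v i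
  have hY : Y ⊆ T := fun i hi => hT₁ i (by simpa [Y] using hi)
  refine (h₁min g g.isLt (X ∪ Y) fun i hi => by simpa [X, Y] using hi).trans ?_
  -- The ends of an edge to be covered are never forced, so `T` without the forced vertices `Y` is
  -- still a cover and is no smaller than the minimum cover `X`.
  have hX : X.card ≤ (T \ Y).card := hg X (T \ Y) (fun i hi => by simpa [X] using hi) (by
    intro i j hij
    refine (hT₂ i j hij).imp (fun hi => ?_) fun hj => ?_
    · refine Finset.mem_sdiff.2 ⟨hi, fun hi' => ?_⟩
      have : AttachForced G C v i := by simpa [Y] using hi'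
      exact hij.2.2.2.2.elim this.2.1 this.2.2
    · refine Finset.mem_sdiff.2 ⟨hj, fun hj' => ?_⟩
      have : AttachForced G C v j := by simpa [Y] using hj'
      exact hij.2.1 this.1)
  have := Finset.card_union_le X Y
  have := Finset.card_sdiff_add_card_eq_card hY
  omega

theorem preserves_minimizeOp : Preserves (fun n (h : State n) =>
    (h.fl.ok, h.num, (fun i : Fin n => (h.st i).C), fun i j => (h.ar i j).E,
      fun i j => (h.ar i j).Q)) minimizeOp :=
  .seq (fun _ _ => rfl) (.for (fun _ _ _ => rfl) (.seq preserves_attachOp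
    (.seq preserves_auctionOp (.for (fun _ _ _ => rfl)
      (.seq preserves_candidateOp preserves_compareOp)))))

theorem minimizeOp_spec {h : State n} (hE : ∀ i j, (h.ar i j).E = true ↔ G.Adj i j)
    (hC : SplitOn G (fun _ => True) fun i => (h.st i).C = true) :
    IsMinDeletionSet IsCluster G (marked fun i => ((minimizeOp n h).st i).B) := by
  let C (i : Fin n) : Prop := (h.st i).C = true
  obtain ⟨h', ⟨-, -, h'B, h'min⟩, e⟩ := forOp_induction (x := fx)
    (φ := attachOp ⨾ auctionOp ⨾ forOp fy (candidateOp ⨾ compareOp))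
    (h := setOp (fun _ s => { s with B := true }) n h)
    (fun k h' => (∀ i j, (h'.ar i j).E = true ↔ G.Adj i j) ∧
      (∀ i, (h'.st i).C = true ↔ C i) ∧
      IsDeletionSet IsCluster G (marked fun i => (h'.st i).B) ∧
      ∀ v : Fin n, v.val < k → ∀ T : Finset (Fin n), (∀ i, AttachForced G C v i → i ∈ T) →
        (∀ i j, AttachEdge G C v i j → i ∈ T ∨ j ∈ T) →
        (marked fun i => (h'.st i).B).card ≤ T.card)
    ⟨hE, fun _ => Iff.rfl, isDeletionSet_isCluster_iff.2 fun a _ _ ha => by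
      exact absurd (mem_marked.2 rfl) ha, fun v hv => absurd hv (Nat.not_lt_zero _)⟩
    (by
      rintro v h' ⟨h'E, h'C, h'B, h'min⟩
      obtain ⟨h₁, h₂, h₃⟩ := level_spec (h := h'.setField fx (single v)) h'E h'C (fun _ => rfl) hC
        h'B rfl
      have hp := (Preserves.seq (ρ := fun n (h : State n) =>
        (fun i : Fin n => (h.st i).C, fun i j => (h.ar i j).E)) preserves_attachOp
        (.seq preserves_auctionOp (.for (x := fy) (fun _ _ _ => rfl)
          (.seq preserves_candidateOp preserves_compareOp)))) n (h'.setField fx (single v))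
      simp only [Prod.mk.injEq, funext_iff] at hp
      refine ⟨fun i j => ?_, fun i => ?_, h₁, fun w hw T hT₁ hT₂ => ?_⟩
      · exact Iff.trans (congrArg (· = true) (hp.2 i j)).to_iff (h'E i j)
      · exact Iff.trans (congrArg (· = true) (hp.1 i)).to_iff (h'C i)
      · rcases Nat.lt_succ_iff_lt_or_eq.1 hw with hw | hw
        · exact h₂.trans (h'min w hw T hT₁ hT₂)
        · obtain rfl := Fin.ext hw
          exact h₃ T hT₁ hT₂)
  have hB : (marked fun i => ((minimizeOp n h).st i).B) = marked fun i => (h'.st i).B := by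
    change (marked fun i => ((forOp fx (attachOp ⨾ auctionOp ⨾ forOp fy (candidateOp ⨾ compareOp))
      n (setOp (fun _ s => { s with B := true }) n h)).st i).B) = _
    rw [e]
    rfl
  rw [hB]
  refine ⟨h'B, fun T hT => ?_⟩
  -- Without vertices there is no `v` to attach, but then the solution is empty.
  rcases Nat.eq_zero_or_pos n with hn | hn
  · subst hn
    simp [Finset.eq_empty_of_isEmpty]
  · have : Nonempty (Fin n) := ⟨⟨0, hn⟩⟩
    obtain ⟨v, hv₁, hv₂⟩ := exists_attach hC hT
    exact h'min v v.isLt T hv₁ hv₂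

/-! ### Comparison with the binary bound -/

/-- The value of a binary number, least significant digit first. -/
def bitsVal : List Bool → ℕ
  | [] => 0
  | b :: l => b.toNat + 2 * bitsVal l

theorem bitsVal_encodeNat (k : ℕ) : bitsVal (encodeNat k) = k := by
  have pos : ∀ m : PosNum, bitsVal (encodePosNum m) = m := by
    intro m
    induction m with
    | one => rfl
    | bit0 m ih => simp [encodePosNum, bitsVal, ih, two_mul]
    | bit1 m ih => simp [encodePosNum, bitsVal, ih, two_mul]; omega
  have num : ∀ m : Num, bitsVal (encodeNum m) = m := by
    rintro (_ | m)
    · rfl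
    · exact pos m
  rw [encodeNat, num, Num.to_of_nat]

theorem borrow_spec (b : Bool) (l : List Bool) :
    ((borrow b l).1 = true ↔ bitsVal l < b.toNat) ∧
      (b.toNat ≤ bitsVal l → bitsVal (borrow b l).2 = bitsVal l - b.toNat) := by
  induction l generalizing b with
  | nil => cases b <;> simp [borrow, bitsVal]
  | cons d l ih =>
    obtain ⟨h₁, h₂⟩ := ih (b && !d)
    simp only [borrow, bitsVal]
    cases b <;> cases d <;> simp_all; omega

/-- Each element of `B` decrements the number, and an underflow clears `ok` for good. After an
underflow the digits are meaningless, so the invariant describes their value only while `ok` holds.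
-/
theorem countOp_spec (h : State n) : (countOp n h).fl.ok = true ↔
    h.fl.ok = true ∧ (marked fun i => (h.st i).B).card ≤ bitsVal h.num := by
  obtain ⟨h', ⟨-, h₂, -⟩, e⟩ := forOp_induction (x := fy) (φ := queryOp (fun _ r _ _ => r.y && r.B)
      (fun f b => { f with d := b }) ⨾
      decOp (fun f => f.d) (fun f b => { f with ok := f.ok && !b })) (h := h)
    (fun k h' => (∀ i, (h'.st i).B = (h.st i).B) ∧
      (h'.fl.ok = true ↔ h.fl.ok = true ∧ countBelow (fun i => (h.st i).B) k ≤ bitsVal h.num) ∧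
      (h'.fl.ok = true → bitsVal h'.num = bitsVal h.num - countBelow (fun i => (h.st i).B) k))
    ⟨fun _ => rfl, by simp, by simp⟩ (by
      rintro k h' ⟨h₁, h₂, h₃⟩
      have hd : decide (∃ i _j : Fin n, (single k i && (h'.st i).B) = true) = (h.st k).B := by
        rw [Bool.eq_iff_iff, decide_eq_true_iff]
        simp only [Bool.and_eq_true, single_eq_true, h₁]
        exact ⟨fun ⟨i, _, h₂, h₃⟩ => h₂ ▸ h₃, fun h₂ => ⟨k, k, rfl, h₂⟩⟩
      obtain ⟨b₁, b₂⟩ := borrow_spec (h.st k).B h'.num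
      set h'' : State n := (queryOp (fun _ r _ _ => r.y && r.B) (fun f b => { f with d := b }) ⨾
        decOp (fun f => f.d) (fun f b => { f with ok := f.ok && !b })) n
          (h'.setField fy (single k)) with hh''
      have hok : h''.fl.ok = (h'.fl.ok && !(borrow (h.st k).B h'.num).1) := by
        rw [← hd]
        rfl
      have hnum : h''.num = (borrow (h.st k).B h'.num).2 := by
        rw [← hd]
        rfl
      have hok' : h''.fl.ok = true ↔ h'.fl.ok = true ∧ (h.st k).B.toNat ≤ bitsVal h'.num := by
        rw [hok, Bool.and_eq_true, Bool.not_eq_true', ← Bool.not_eq_true, b₁, not_lt]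
      rw [countBelow_succ]
      refine ⟨h₁, ?_, fun h => ?_⟩
      · rw [hok', h₂]
        constructor
        · rintro ⟨h₄, h₅⟩
          rw [h₃ (h₂.2 h₄)] at h₅
          exact ⟨h₄.1, by have := h₄.2; omega⟩
        · rintro ⟨h₄, h₅⟩
          have h₆ := h₂.2 ⟨h₄, by omega⟩
          rw [h₃ h₆]
          exact ⟨⟨h₄, by omega⟩, by omega⟩
      · rw [hok'] at h
        rw [hnum, b₂ h.2, h₃ h.1, Nat.sub_sub])
  unfold countOp
  rw [e, ← countBelow_self]
  exact h₂

end Correctness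

/-! ### The complete algorithm and its machines -/

theorem solveOp_spec {n : ℕ} {G : SimpleGraph (Fin n)} (co : Bool) {h : State n}
    (hE : ∀ i j, (h.ar i j).E = true ↔ G.Adj i j) (hQ : ∀ i j, (h.ar i j).Q = false)
    (hU : ∀ i, (h.st i).U = false) {G' : SimpleGraph (Fin n)} (hG' : G' = bif co then Gᶜ else G) :
    ((solveOp co n h).fl.ok = true ↔ IsSplit G') ∧
      (IsSplit G' →
        IsMinDeletionSet IsCluster G' (marked fun i => ((solveOp co n h).st i).B)) ∧
      (∀ i j, ((solveOp co n h).ar i j).Q = true ↔ i = j) ∧ (solveOp co n h).num = h.num := by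
  set h₁ : State n := complOp co n (diagOp n h) with hh₁
  have h₁Q : ∀ i j, (h₁.ar i j).Q = true ↔ i = j := diagOp_Q h hQ
  have h₁E : ∀ i j, (h₁.ar i j).E = true ↔ G'.Adj i j := fun i j => by
    have : (h₁.ar i j).E = ((((diagOp n h).ar i j).E ^^ co) && !((diagOp n h).ar i j).Q) := rfl
    rw [this, Bool.and_eq_true, Bool.not_eq_true', ← Bool.not_eq_true, diagOp_Q h hQ, diagOp_E, hG']
    cases co
    · rw [Bool.xor_false, hE, cond_false]
      exact and_iff_left_of_imp SimpleGraph.Adj.ne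
    · rw [Bool.xor_true, Bool.not_eq_true', ← Bool.not_eq_true, hE, cond_true,
        SimpleGraph.compl_adj, and_comm]
  have p₁ := (preserves_splitOp (ρ := fun n (h : State n) =>
    (h.num, (fun i j => (h.ar i j).E), fun i j => (h.ar i j).Q))) n h₁
  have p₂ := preserves_minimizeOp n (splitOp n h₁)
  simp only [Prod.mk.injEq, funext_iff] at p₁ p₂
  obtain ⟨hok, hC⟩ := splitOp_spec h₁E h₁Q fun i => (diagOp_st h i).trans (hU i)
  refine ⟨?_, fun hG => ?_, fun i j => ?_, ?_⟩
  · rw [← hok, ← p₂.1]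
    rfl
  · exact minimizeOp_spec (fun i j => by rw [p₁.2.1 i j, h₁E]) (hC hG)
  · rw [← h₁Q, ← p₁.2.2 i j, ← p₂.2.2.2.2 i j]
    rfl
  · exact p₂.2.1.trans (p₁.1.trans (diagOp_num h))

/-- How instances are read. -/
def input : Input Flags Rec Ent where
  fl := ⟨false, false, false, false, false, false⟩
  st := ⟨false, false, false, false, false, false, false, false, false, false, false, false, false,
    false, false, false⟩
  ar b := ⟨b, false, false, false, false⟩
  bit := Ent.E
  bit_ar _ := rfl

/-- The output of the optimization algorithm. -/
def solutionOutput : Output Flags Rec Ent where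
  bit
    | .data r _ e => if e.Q then some r.B else none
    | _ => none
  first _ := none

/-- The output of the decision algorithm. -/
def answerOutput : Output Flags Rec Ent where
  bit _ := none
  first f := some f.ok

/-- Each record occurs in many cells; reading only the diagonal entries yields one bit for each
vertex, in order. -/
theorem solutionOutput_word {n : ℕ} {h : State n} (hQ : ∀ i j, (h.ar i j).Q = true ↔ i = j) :
    solutionOutput.word h = (List.finRange n).map fun i => (h.st i).B := by
  have row : ∀ (i : Fin n) (l : List (Fin n)), l.Nodup →
      (l.map fun j => Cell.data (h.st i) (h.st j) (h.ar i j)).filterMap solutionOutput.bit =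
        if i ∈ l then [(h.st i).B] else [] := by
    intro i l hl
    induction l with
    | nil => rfl
    | cons j l ih =>
      obtain ⟨hj, hl⟩ := List.nodup_cons.1 hl
      rw [List.map_cons, List.filterMap_cons, ih hl]
      by_cases hij : i = j
      · subst hij
        simp [solutionOutput, hQ, hj]
      · simp [solutionOutput, hQ, hij]
  have num : ∀ l : List Bool, (l.map Cell.num).filterMap solutionOutput.bit = [] := fun l => by
    simp [solutionOutput]
  have rows' : ∀ l : List (Fin n), (l.flatMap fun i => (List.finRange n).map
      (fun j => Cell.data (h.st i) (h.st j) (h.ar i j)) ++ [.sep]).filterMap solutionOutput.bit =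
      l.map fun i => (h.st i).B := by
    intro l
    induction l with
    | nil => rfl
    | cons i l ih =>
      rw [List.flatMap_cons, List.filterMap_append, ih, List.filterMap_append,
        row i _ (List.nodup_finRange n), if_pos (List.mem_finRange i)]
      rfl
  unfold Output.word MState.cells rows
  rw [List.filterMap_append, num, rows']
  simp [solutionOutput]

theorem answerOutput_word {n : ℕ} (h : State n) : answerOutput.word h = [h.fl.ok] := by
  simp [Output.word, answerOutput]

open Classical in
/-- The adjacency matrix. -/
noncomputable def adjBits (G : FinGraph) (i j : Fin G.1) : Bool := decide (G.2.Adj i j)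

theorem adjBits_eq_true {G : FinGraph} (i j : Fin G.1) : adjBits G i j = true ↔ G.2.Adj i j := by
  simp [adjBits]

/-- The initial state for a graph. -/
noncomputable def initial (G : FinGraph) (l : List Bool) : State G.1 := input.state (adjBits G) l

theorem solveOp_initial (co : Bool) (G : FinGraph) (l : List Bool) {G' : SimpleGraph (Fin G.1)}
    (hG' : G' = bif co then G.2ᶜ else G.2) :
    ((solveOp co G.1 (initial G l)).fl.ok = true ↔ IsSplit G') ∧
      (IsSplit G' →
        IsMinDeletionSet IsCluster G' (marked fun i => ((solveOp co G.1 (initial G l)).st i).B)) ∧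
      (∀ i j, ((solveOp co G.1 (initial G l)).ar i j).Q = true ↔ i = j) ∧
      (solveOp co G.1 (initial G l)).num = l :=
  solveOp_spec co adjBits_eq_true (fun _ _ => rfl) (fun _ => rfl) hG'

/-- The equivalence is needed for split graphs only: the optimization form promises a split graph,
and the decision algorithm rejects every other graph through the flag `ok`. For split graphs, a
solution of size at most `k` exists iff the computed minimum one has size at most `k`. -/
theorem inP_of_iff (co : Bool) {C : GraphClass}
    (hC : ∀ {n : ℕ} {G : SimpleGraph (Fin n)}, IsSplit G → ∀ S,
      (IsDeletionSet C G S ↔ IsDeletionSet IsCluster (bif co then Gᶜ else G) S)) :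
    InP IsSplit C := by
  have hco : ∀ {n : ℕ} {G : SimpleGraph (Fin n)},
      IsSplit (bif co then Gᶜ else G) ↔ IsSplit G := by
    cases co
    · exact Iff.rfl
    · exact isSplit_compl_iff
  classical
  constructor
  · refine ⟨fun G => marked fun i => ((solveOp co G.1.1 (initial G.1 [])).st i).B, fun G => ?_, ?_⟩
    · obtain ⟨-, h, -, -⟩ := solveOp_initial co G.1 [] rfl
      obtain ⟨h₁, h₂⟩ := h (hco.2 G.2)
      exact ⟨(hC G.2 _).2 h₁, fun T hT => h₂ T ((hC G.2 _).1 hT)⟩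
    · refine (feasible_solveOp co).computable input solutionOutput fun G =>
        ⟨G.1.1, adjBits G.1, [], ?_, ?_⟩
      · simp [encodeGraph, matrixWord, adjBits]
      · refine Eq.trans ?_ (solutionOutput_word (solveOp_initial co G.1 [] rfl).2.2.1).symm
        simp [encodeVertexSet]
  · refine (feasible_decideOp co).computable input answerOutput fun x =>
      ⟨x.1.1, adjBits x.1, encodeNat x.2, rfl, ?_⟩
    refine Eq.trans ?_ (answerOutput_word (countOp x.1.1 (solveOp co x.1.1
      (initial x.1 (encodeNat x.2))))).symm
    obtain ⟨h₁, h₂, -, h₃⟩ := solveOp_initial co x.1 (encodeNat x.2) rfl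
    refine congrArg (fun b => [b]) ?_
    rw [Bool.eq_iff_iff, decide_eq_true_iff, countOp_spec, h₁, h₃, bitsVal_encodeNat, hco]
    refine and_congr_right fun hG => ?_
    obtain ⟨h₄, h₅⟩ := h₂ (hco.2 hG)
    exact ⟨fun ⟨S, hS, hS'⟩ => (h₅ S ((hC hG S).1 hS')).trans hS,
      fun h => ⟨_, h, (hC hG _).2 h₄⟩⟩

end VertexDeletion

theorem mainTheorem10 :
    VertexDeletion.InP VertexDeletion.IsSplit VertexDeletion.IsCluster ∧
      VertexDeletion.InP VertexDeletion.IsSplit VertexDeletion.IsCompleteSplit :=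
  ⟨VertexDeletion.inP_of_iff false fun _ _ => Iff.rfl,
    VertexDeletion.inP_of_iff true fun h _ => VertexDeletion.isDeletionSet_isCompleteSplit_iff h⟩
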